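/- Let $d\ge1$ and $k\ge1$ be integers and $s_0\in\mathbb R$. Equip $[0,1]^d$ with the toroidal metric $\mathsf{dist}(x,y)=\min_{z\in\mathbb Z^d}\|x-y+z\|$, where $\|\cdot\|$ is the Euclidean norm, and write $B_r(x)=\{y\in[0,1]^d:\mathsf{dist}(x,y)\le r\}$. Let $\theta_d$ be the volume of the Euclidean unit ball in $\mathbb R^d$. Let $(a_n)_{n\ge1}$ be a real sequence with $$a_n-\log n-(k-1)\log\log n\to\infty\qquad(n\to\infty),$$ and put $$b_n=n\,a_n^{k-1}e^{-a_n},\qquad r_n=\Big(\frac{a_n+s_0}{n\theta_d}\Big)^{1/d},\qquad \alpha_k=\frac{e^{-s_0}}{(k-1)!}$$ ($a_n$, and hence $a_n+s_0$ and $b_n$, are positive for all large $n$). For a finite point configuration $\omega$ in $[0,1]^d$, counted with multiplicity, let $\omega(A)$ be the number of points of $\omega$ in $A$, and let $$T_n(\omega)=\sum_{X\in\omega}\mathbf 1\{\omega(B_{r_n}(X))\le k\}.$$ (i) For each $n\ge1$ let $\mathcal P_n$ be a homogeneous Poisson point process on $[0,1]^d$ with intensity $n$, and let $T_{k,n}=T_n(\mathcal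 P_n)$. If $a_n=o(n)$, then $b_n^{-1}\,\mathbb P(T_{k,n}\ge1)\to\alpha_k$ as $n\to\infty$. (ii) Let $X_1,X_2,\dots$ be i.i.d. uniform random points of $[0,1]^d$, let $\mathcal B_n=\{X_1,\dots,X_n\}$, and let $T^{\mathsf B}_{k,n}=T_n(\mathcal B_n)$. If $a_n=o(n^{1/3})$, then $b_n^{-1}\,\mathbb P(T^{\mathsf B}_{k,n}\ge1)\to\alpha_k$ as $n\to\infty$. -/

import Mathlib

open MeasureTheory ProbabilityTheory Filter Topology Asymptotics
open scoped NNReal ENNReal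

noncomputable section

namespace KNN

/-- The unit cube `[0,1]^d` in Euclidean space. -/
def unitCube (d : ℕ) : Set (EuclideanSpace ℝ (Fin d)) :=
  {x | ∀ i, x i ∈ Set.Icc (0 : ℝ) 1}

/-- Lebesgue measure on the unit cube, that is, the uniform distribution on `[0,1]^d`. -/
def cubeMeasure (d : ℕ) : Measure (EuclideanSpace ℝ (Fin d)) :=
  volume.restrict (unitCube d)

instance (d : ℕ) : IsProbabilityMeasure (cubeMeasure d) := by
  constructor
  have hmp := EuclideanSpace.volume_preserving_symm_measurableEquiv_toLp (Fin d)
  have h : unitCube d = (MeasurableEquiv.toLp 2 (Fin d → ℝ)).symm ⁻¹'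
      (Set.univ.pi fun _ => Set.Icc (0 : ℝ) 1) := by
    ext x
    simp only [unitCube, Set.mem_preimage, Set.mem_univ_pi]
    rfl
  rw [cubeMeasure, Measure.restrict_apply_univ, h,
    hmp.measure_preimage (MeasurableSet.univ_pi fun _ => measurableSet_Icc).nullMeasurableSet,
    volume_pi_pi]
  simp

/-- The toroidal metric `min_{z ∈ ℤ^d} ‖x - y + z‖`. -/
def torusDist {d : ℕ} (x y : EuclideanSpace ℝ (Fin d)) : ℝ :=
  ⨅ z : Fin d → ℤ, ‖x - y + WithLp.toLp 2 (fun i => (z i : ℝ))‖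

/-- The closed ball `B_r(x)` of the cube for the toroidal metric. -/
def torusBall {d : ℕ} (x : EuclideanSpace ℝ (Fin d)) (r : ℝ) :
    Set (EuclideanSpace ℝ (Fin d)) :=
  {y ∈ unitCube d | torusDist x y ≤ r}

open Classical in
/-- The number `ω(A)` of points of a finite configuration `ω` that lie in `A`. A finite point
measure `∑ δ_{x_i}` is represented by the multiset of its atoms. -/
def count {E : Type*} (ω : Multiset E) (A : Set E) : ℕ :=
  ω.countP (fun x => x ∈ A)

/-- `P` is a Poisson point process with finite intensity measure `Λ`: the number of points in a
measurable set `A` is Poisson distributed with mean `Λ A`, and the numbers of points in finitely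
many pairwise disjoint measurable sets are independent. -/
structure IsPoissonProcess {Ω E : Type*} [MeasurableSpace Ω] [MeasurableSpace E]
    (P : Ω → Multiset E) (Λ : Measure E) [IsFiniteMeasure Λ] (μ : Measure Ω) : Prop where
  measurable_count : ∀ A : Set E, MeasurableSet A → Measurable fun w => count (P w) A
  law_count : ∀ A : Set E, MeasurableSet A →
    μ.map (fun w => count (P w) A) = poissonMeasure (Λ A).toNNReal
  indep_count : ∀ (m : ℕ) (A : Fin m → Set E), (∀ j, MeasurableSet (A j)) →
    Pairwise (fun i j => Disjoint (A i) (A j)) →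
    iIndepFun (fun j w => count (P w) (A j)) μ

/-- The binomial point process `{X_1, …, X_n}` formed by the first `n` terms of a sequence. -/
def binomialProcess {Ω E : Type*} (X : ℕ → Ω → E) (n : ℕ) (w : Ω) : Multiset E :=
  (Multiset.range n).map fun i => X i w

/-- The volume `θ_d` of the Euclidean unit ball in `ℝ^d`. -/
def theta (d : ℕ) : ℝ :=
  (volume (Metric.ball (0 : EuclideanSpace ℝ (Fin d)) 1)).toReal

/-- The radius `r_n(s) = ((a_n + s) / (n θ_d))^{1/d}`. -/
def radius (d : ℕ) (a : ℕ → ℝ) (s : ℝ) (n : ℕ) : ℝ :=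
  ((a n + s) / (n * theta d)) ^ (1 / (d : ℝ))

/-- The scaling constants `b_n = n a_n^{k-1} e^{-a_n}` (for `k ≥ 1`). -/
def scaling (k : ℕ) (a : ℕ → ℝ) (n : ℕ) : ℝ :=
  n * a n ^ (k - 1) * Real.exp (-a n)

/-- The limit `α_k = e^{-s} / (k-1)!` (for `k ≥ 1`). -/
def alpha (k : ℕ) (s : ℝ) : ℝ :=
  Real.exp (-s) / (k - 1).factorial

open Classical in
/-- The number of points `x` of the configuration `ω`, counted with multiplicity, for which the
ball `B_r(x)` contains at most `k` points of `ω` (including `x` itself). -/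
def lowDegreeCount {d : ℕ} (k : ℕ) (r : ℝ) (ω : Multiset (EuclideanSpace ℝ (Fin d))) : ℕ :=
  ω.countP (fun x => count ω (torusBall x r) ≤ k)

end KNN

end

/-!
The number `T` of points of low degree has a mean that tends to `0`, so `ℙ(T ≥ 1)` is compared with
`𝔼 T` through the inequalities `𝔼 T - 𝔼[T (T - 1)] ≤ ℙ(T ≥ 1) ≤ 𝔼 T`. The point is that
`𝔼[T (T - 1)] = o(𝔼 T)`.

*Binomial process.* Once the balls are small enough to embed into the torus, all have the same
volume `v = (a n + s₀) / n` (`cubeMeasure_torusBall`), so `𝔼 T` is `n` times the probability that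
fewer than `k` of `n - 1` points fall into a cell of probability `v`. Given the positions of a pair
of points, the event that both have low degree is controlled by a trinomial probability for two
disjoint cells. The three terms of `pairBound` are as follows, with `ε` a small parameter.
At distance more than `2 r` the balls are disjoint and the probabilities multiply. Between `ε r` and
`2 r`, the second ball contains a ball of proportional volume that the first one misses
(`exists_torusBall_subset_disjoint`), which costs an exponential factor in `a n`. Below `ε r` each
point lies in the other's ball, so that only `k - 2` further points are allowed: this gains a
factor of order `1 / a n`, which offsets the expected number of neighbours, and the volume of such
pairs leaves the factor `ε ^ d`, with `ε` arbitrary. The result is `binomial_probability_bounds`.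

*Poisson process.* A Poisson process is determined only through its counts, which suffices: after
the points are replaced by labels from a fine finite partition, the occupation numbers have the law
of those of a binomial process with a Poisson number of points (only the number of points equal to
the sum of the occupation numbers contributes), and for each finite configuration the labelled event
is eventually the exact one. So `ℙ(T ≥ 1)` is the Poisson mixture of the binomial probabilities
(`IsPoissonProcess.hasSum_lowDegree`). Mixing the binomial bounds turns the trinomial
probabilities into products of Poisson probabilities (`poisson_probability_bounds`); conversely
`pairBound_le` bounds the binomial pair terms by a constant times the Poisson ones, so that one
asymptotic computation (`exists_tendsto_poissonPairBound_div_scaling`) serves both processes.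
-/

namespace KNN

/-! ### The toroidal metric and the volume of its balls -/

section Torus

open scoped Pointwise

variable {d : ℕ}

/-- The vector of `ℝ^d` with the given integer coordinates. -/
def intVec (z : Fin d → ℤ) : EuclideanSpace ℝ (Fin d) :=
  WithLp.toLp 2 (fun i => (z i : ℝ))

lemma intVec_add (z z' : Fin d → ℤ) : intVec (z + z') = intVec z + intVec z' := by
  ext i; simp [intVec]

lemma intVec_neg (z : Fin d → ℤ) : intVec (-z) = -intVec z := by
  ext i; simp [intVec]

lemma intVec_zero : intVec (0 : Fin d → ℤ) = 0 := by
  ext i; simp [intVec]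

lemma one_le_norm_intVec {z : Fin d → ℤ} (hz : z ≠ 0) : 1 ≤ ‖intVec z‖ := by
  obtain ⟨i, hi⟩ := Function.ne_iff.1 hz
  have h1 : ‖(intVec z) i‖ ≤ ‖intVec z‖ := PiLp.norm_apply_le _ i
  have h2 : (1 : ℝ) ≤ ‖(intVec z) i‖ := by
    simp only [intVec, Real.norm_eq_abs]
    exact_mod_cast Int.one_le_abs hi
  exact h2.trans h1

lemma torusDist_le_norm_add (x y : EuclideanSpace ℝ (Fin d)) (z : Fin d → ℤ) :
    torusDist x y ≤ ‖x - y + intVec z‖ :=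
  ciInf_le ⟨0, by rintro _ ⟨z, rfl⟩; exact norm_nonneg _⟩ z

lemma exists_norm_add_lt {x y : EuclideanSpace ℝ (Fin d)} {c : ℝ} (h : torusDist x y < c) :
    ∃ z, ‖x - y + intVec z‖ < c :=
  exists_lt_of_ciInf_lt h

lemma torusDist_nonneg (x y : EuclideanSpace ℝ (Fin d)) : 0 ≤ torusDist x y :=
  Real.iInf_nonneg fun _ => norm_nonneg _

lemma torusDist_le_norm (x y : EuclideanSpace ℝ (Fin d)) : torusDist x y ≤ ‖x - y‖ := by
  simpa [intVec_zero] using torusDist_le_norm_add x y 0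

lemma torusDist_self (x : EuclideanSpace ℝ (Fin d)) : torusDist x x = 0 :=
  le_antisymm (by simpa using torusDist_le_norm x x) (torusDist_nonneg _ _)

lemma torusDist_triangle (x y z : EuclideanSpace ℝ (Fin d)) :
    torusDist x z ≤ torusDist x y + torusDist y z := by
  refine le_of_forall_pos_lt_add fun ε hε => ?_
  obtain ⟨u, hu⟩ := exists_norm_add_lt (show torusDist x y < torusDist x y + ε / 2 by linarith)
  obtain ⟨v, hv⟩ := exists_norm_add_lt (show torusDist y z < torusDist y z + ε / 2 by linarith)
  have h := torusDist_le_norm_add x z (u + v)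
  have h2 : x - z + intVec (u + v) = (x - y + intVec u) + (y - z + intVec v) := by
    rw [intVec_add]; abel
  rw [h2] at h
  linarith [norm_add_le (x - y + intVec u) (y - z + intVec v)]

lemma torusDist_comm_le (x y : EuclideanSpace ℝ (Fin d)) : torusDist x y ≤ torusDist y x := by
  refine le_of_forall_pos_lt_add fun ε hε => ?_
  obtain ⟨u, hu⟩ := exists_norm_add_lt (show torusDist y x < torusDist y x + ε by linarith)
  have h := torusDist_le_norm_add x y (-u)
  rw [intVec_neg, show x - y + -intVec u = -(y - x + intVec u) by abel, norm_neg] at h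
  linarith

lemma torusDist_comm (x y : EuclideanSpace ℝ (Fin d)) : torusDist x y = torusDist y x :=
  le_antisymm (torusDist_comm_le _ _) (torusDist_comm_le _ _)

/-- The toroidal distance does not depend on the representative modulo `ℤ^d`. -/
lemma torusDist_add_intVec (x y : EuclideanSpace ℝ (Fin d)) (z : Fin d → ℤ) :
    torusDist x (y + intVec z) = torusDist x y := by
  have key : ∀ (u : EuclideanSpace ℝ (Fin d)) (z : Fin d → ℤ), torusDist u (u + intVec z) = 0 :=
    fun u z => le_antisymm
      (by simpa [sub_add_eq_sub_sub] using torusDist_le_norm_add u (u + intVec z) z)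
      (torusDist_nonneg _ _)
  refine le_antisymm ?_ ?_
  · simpa [key] using torusDist_triangle x y (y + intVec z)
  · simpa [key, torusDist_comm (y + intVec z) y] using torusDist_triangle x (y + intVec z) y

/-- At Euclidean distance at most `1 / 2`, the zero vector already realizes the infimum over the
lattice. -/
lemma torusDist_eq_norm {x y : EuclideanSpace ℝ (Fin d)} (h : ‖x - y‖ ≤ 1 / 2) :
    torusDist x y = ‖x - y‖ := by
  refine le_antisymm (torusDist_le_norm x y) (le_ciInf fun z => ?_)
  change ‖x - y‖ ≤ ‖x - y + intVec z‖
  by_cases hz : z = 0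
  · simp [hz, intVec_zero]
  · have h1 := one_le_norm_intVec hz
    have h2 : ‖intVec z‖ ≤ ‖x - y + intVec z‖ + ‖x - y‖ := by
      simpa using norm_sub_le (x - y + intVec z) (x - y)
    linarith

lemma abs_torusDist_sub_le (x y x' y' : EuclideanSpace ℝ (Fin d)) :
    |torusDist x y - torusDist x' y'| ≤ ‖x - x'‖ + ‖y - y'‖ := by
  have h : ∀ x y x' y' : EuclideanSpace ℝ (Fin d),
      torusDist x y ≤ torusDist x' y' + ‖x - x'‖ + ‖y - y'‖ := fun x y x' y' => by
    have h1 := torusDist_triangle x x' y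
    have h2 := torusDist_triangle x' y' y
    have h3 := torusDist_le_norm x x'
    have h4 := torusDist_le_norm y' y
    rw [norm_sub_rev] at h4
    linarith
  have h1 := h x y x' y'
  have h2 := h x' y' x y
  rw [norm_sub_rev x', norm_sub_rev y'] at h2
  rw [abs_le]
  constructor <;> linarith

lemma continuous_torusDist :
    Continuous fun p : EuclideanSpace ℝ (Fin d) × EuclideanSpace ℝ (Fin d) =>
      torusDist p.1 p.2 := by
  refine (LipschitzWith.of_dist_le_mul (K := 2) fun p q => ?_).continuous
  rw [Real.dist_eq]
  refine (abs_torusDist_sub_le _ _ _ _).trans ?_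
  have h1 : ‖p.1 - q.1‖ ≤ dist p q := by rw [← dist_eq_norm]; exact le_max_left _ _
  have h2 : ‖p.2 - q.2‖ ≤ dist p q := by rw [← dist_eq_norm]; exact le_max_right _ _
  push_cast
  linarith

lemma measurable_torusDist :
    Measurable fun p : EuclideanSpace ℝ (Fin d) × EuclideanSpace ℝ (Fin d) =>
      torusDist p.1 p.2 :=
  continuous_torusDist.measurable

lemma isClosed_unitCube : IsClosed (unitCube d) := by
  have : unitCube d = ⋂ i, {x | x i ∈ Set.Icc (0 : ℝ) 1} := by ext; simp [unitCube]
  rw [this]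
  exact isClosed_iInter fun i => isClosed_Icc.preimage (by fun_prop)

lemma measurableSet_unitCube : MeasurableSet (unitCube d) := isClosed_unitCube.measurableSet

lemma isCompact_unitCube : IsCompact (unitCube d) := by
  refine Metric.isCompact_of_isClosed_isBounded isClosed_unitCube ?_
  have : unitCube d ⊆ (WithLp.toLp 2) '' (Set.univ.pi fun _ : Fin d => Set.Icc (0 : ℝ) 1) := by
    intro x hx
    exact ⟨fun i => x i, fun i _ => hx i, rfl⟩
  exact ((isCompact_univ_pi fun _ => isCompact_Icc).image
    (PiLp.continuous_toLp 2 _)).isBounded.subset this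

lemma measurableSet_torusBall (x : EuclideanSpace ℝ (Fin d)) (r : ℝ) :
    MeasurableSet (torusBall x r) :=
  measurableSet_unitCube.inter
    (measurable_torusDist.comp measurable_prodMk_left measurableSet_Iic)

lemma mem_torusBall_self {x : EuclideanSpace ℝ (Fin d)} (hx : x ∈ unitCube d) {r : ℝ}
    (hr : 0 ≤ r) : x ∈ torusBall x r :=
  ⟨hx, by rwa [torusDist_self]⟩

lemma theta_nonneg : 0 ≤ theta d := ENNReal.toReal_nonneg

lemma theta_pos : 0 < theta d :=
  ENNReal.toReal_pos (Metric.measure_ball_pos _ _ one_pos).ne' measure_ball_lt_top.ne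

/-- A toroidal ball of radius less than `1/2` has the volume of the Euclidean ball: its preimage
under the covering `ℝ^d → ℝ^d / ℤ^d` is a disjoint union of Euclidean balls, and the unit cube is
a fundamental domain. -/
lemma cubeMeasure_torusBall (x : EuclideanSpace ℝ (Fin d)) {r : ℝ} (h0 : 0 ≤ r)
    (hr : r < 1 / 2) :
    cubeMeasure d (torusBall x r) = ENNReal.ofReal (r ^ d * theta d) := by
  let b := (EuclideanSpace.basisFun (Fin d) ℝ).toBasis
  have hF := ZSpan.isAddFundamentalDomain' b (volume : Measure (EuclideanSpace ℝ (Fin d)))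
  have hball : volume (Metric.closedBall x r) = ENNReal.ofReal (r ^ d * theta d) := by
    rw [Measure.addHaar_closedBall _ _ h0, finrank_euclideanSpace_fin,
      ENNReal.ofReal_mul (by positivity), theta, ENNReal.ofReal_toReal measure_ball_lt_top.ne]
  have hmem : ∀ y, y ∈ ZSpan.fundamentalDomain b ↔ ∀ i, y i ∈ Set.Ico (0 : ℝ) 1 := by
    intro y
    simp [ZSpan.mem_fundamentalDomain, b]
  have hlat : ∀ y, y ∈ Submodule.span ℤ (Set.range b) ↔ ∃ z, y = intVec z := by
    intro y
    rw [Module.Basis.mem_span_iff_repr_mem]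
    constructor
    · intro h
      choose z hz using h
      refine ⟨z, ?_⟩
      ext i
      simpa [b, intVec] using (hz i).symm
    · rintro ⟨z, rfl⟩ i
      exact ⟨z i, by simp [b, intVec]⟩
  have hae : (ZSpan.fundamentalDomain b : Set (EuclideanSpace ℝ (Fin d))) =ᵐ[volume]
      unitCube d := by
    have hmp := EuclideanSpace.volume_preserving_symm_measurableEquiv_toLp (Fin d)
    have h := hmp.quasiMeasurePreserving.preimage_ae_eq
      (Measure.univ_pi_Ico_ae_eq_Icc (μ := fun _ : Fin d => (volume : Measure ℝ))
        (f := fun _ => 0) (g := fun _ => 1))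
    have h1 : (MeasurableEquiv.toLp 2 (Fin d → ℝ)).symm ⁻¹'
        (Set.univ.pi fun _ => Set.Ico (0 : ℝ) 1) = ZSpan.fundamentalDomain b := by
      ext y
      rw [hmem, Set.mem_preimage, Set.mem_univ_pi]
      rfl
    have h2 : (MeasurableEquiv.toLp 2 (Fin d → ℝ)).symm ⁻¹'
        (Set.Icc (fun _ => 0) (fun _ => 1)) = unitCube d := by
      rw [← Set.pi_univ_Icc]
      ext y
      rw [Set.mem_preimage, Set.mem_univ_pi]
      rfl
    rwa [h1, h2] at h
  have hvadd : ∀ (g : (Submodule.span ℤ (Set.range b)).toAddSubgroup)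
      (y : EuclideanSpace ℝ (Fin d)), y ∈ g +ᵥ Metric.closedBall x r ↔
        ‖x - y + (g : EuclideanSpace ℝ (Fin d))‖ ≤ r := by
    intro g y
    rw [Set.mem_vadd_set_iff_neg_vadd_mem, Metric.mem_closedBall', dist_eq_norm]
    have : -g +ᵥ y = -(g : EuclideanSpace ℝ (Fin d)) + y := rfl
    rw [this, show x - (-(g : EuclideanSpace ℝ (Fin d)) + y) = x - y + g by abel]
  have hmemU : ∀ y, y ∈ (⋃ g : (Submodule.span ℤ (Set.range b)).toAddSubgroup,
      ((g +ᵥ Metric.closedBall x r) ∩ ZSpan.fundamentalDomain b)) ↔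
        torusDist x y ≤ r ∧ y ∈ ZSpan.fundamentalDomain b := by
    intro y
    simp only [Set.mem_iUnion, Set.mem_inter_iff, hvadd, exists_and_right]
    refine and_congr_left fun _ => ⟨?_, fun h => ?_⟩
    · rintro ⟨⟨g, hg⟩, hgr⟩
      obtain ⟨z, rfl⟩ := (hlat g).1 hg
      exact (torusDist_le_norm_add x y z).trans hgr
    · obtain ⟨z, hz⟩ := exists_norm_add_lt (h.trans_lt hr)
      refine ⟨⟨intVec z, (hlat _).2 ⟨z, rfl⟩⟩, ?_⟩
      -- a representative at distance less than `1/2` realizes the infimum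
      have h1 : x - y + intVec z = x - (y + intVec (-z)) := by rw [intVec_neg]; abel
      rw [h1] at hz
      rw [← torusDist_add_intVec x y (-z), torusDist_eq_norm hz.le, ← h1] at h
      exact h
  have hmeas : ∀ g : (Submodule.span ℤ (Set.range b)).toAddSubgroup,
      MeasurableSet (g +ᵥ Metric.closedBall x r) := fun g => by
    have : g +ᵥ Metric.closedBall x r =
        {y | ‖x - y + (g : EuclideanSpace ℝ (Fin d))‖ ≤ r} := Set.ext (hvadd g)
    rw [this]
    exact measurableSet_le (by fun_prop) measurable_const
  have : Countable (Submodule.span ℤ (Set.range b)).toAddSubgroup :=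
    inferInstanceAs (Countable (Submodule.span ℤ (Set.range b)))
  have hsum := hF.measure_eq_tsum (Metric.closedBall x r)
  rw [hball, ← measure_iUnion] at hsum
  · rw [hsum, cubeMeasure, Measure.restrict_apply (measurableSet_torusBall x r)]
    refine measure_congr ?_
    filter_upwards [hae] with y hy
    have hy' : y ∈ ZSpan.fundamentalDomain b ↔ y ∈ unitCube d := iff_of_eq hy
    refine propext ?_
    change y ∈ torusBall x r ∩ unitCube d ↔
      y ∈ ⋃ g : (Submodule.span ℤ (Set.range b)).toAddSubgroup,
      ((g +ᵥ Metric.closedBall x r) ∩ ZSpan.fundamentalDomain b)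
    rw [hmemU, hy']
    exact ⟨fun h => ⟨h.1.2, h.2⟩, fun h => ⟨⟨h.2, h.1⟩, h.2⟩⟩
  · intro g g' hgg
    refine Set.disjoint_left.2 fun y hy hy' => hgg ?_
    have h1 := (hvadd g y).1 hy.1
    have h2 := (hvadd g' y).1 hy'.1
    obtain ⟨z, hz⟩ := (hlat _).1 (g - g').2
    by_contra hne
    have hz0 : z ≠ 0 := by
      rintro rfl
      rw [intVec_zero] at hz
      exact hne (sub_eq_zero.1 (Subtype.ext hz))
    have h3 := one_le_norm_intVec hz0
    have h4 : intVec z = (x - y + (g : EuclideanSpace ℝ (Fin d))) - (x - y + g') := by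
      rw [← hz]; simp
    have h5 := norm_sub_le (x - y + (g : EuclideanSpace ℝ (Fin d))) (x - y + g')
    rw [← h4] at h5
    linarith
  · exact fun g => (hmeas g).inter (ZSpan.fundamentalDomain_measurableSet b)

lemma disjoint_torusBall {x y : EuclideanSpace ℝ (Fin d)} {r ρ : ℝ} (h : r + ρ < torusDist x y) :
    Disjoint (torusBall x r) (torusBall y ρ) := by
  refine Set.disjoint_left.2 fun w hw hw' => ?_
  have h1 := torusDist_triangle x w y
  rw [torusDist_comm w y] at h1
  linarith [hw.2, hw'.2]

/-- Two balls of radius `r` whose centres are not too close differ by at least a fixed fraction: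
the second contains a ball of radius `ε r / 4`, centred on the far side of its centre, that the
first does not meet. -/
lemma exists_torusBall_subset_disjoint {x y : EuclideanSpace ℝ (Fin d)} {r ε : ℝ} (hr : 0 < r)
    (hε : 0 < ε) (hε1 : ε ≤ 1) (hr2 : r ≤ 1 / 6) (h1 : ε * r ≤ torusDist x y)
    (h2 : torusDist x y ≤ 2 * r) :
    ∃ z, Disjoint (torusBall x r) (torusBall z (ε / 4 * r)) ∧
      torusBall z (ε / 4 * r) ⊆ torusBall y r := by
  obtain ⟨u, hu⟩ := exists_norm_add_lt (show torusDist x y < 1 / 2 by linarith)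
  set y' := y + intVec (-u) with hy'
  have e1 : x - y + intVec u = x - y' := by rw [hy', intVec_neg]; abel
  rw [e1] at hu
  have hD : torusDist x y = ‖x - y'‖ := by
    rw [← torusDist_add_intVec x y (-u), torusDist_eq_norm hu.le]
  rw [hD] at h1 h2
  have hpos : 0 < ‖x - y'‖ := lt_of_lt_of_le (by positivity) h1
  set t : ℝ := (1 - ε / 4) * r / ‖x - y'‖ with ht
  have ht0 : 0 ≤ t := div_nonneg (mul_nonneg (by linarith) hr.le) hpos.le
  have htD : t * ‖x - y'‖ = (1 - ε / 4) * r := div_mul_cancel₀ _ hpos.ne'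
  set z := y' + t • (y' - x) with hz
  have hyz : ‖y' - z‖ = (1 - ε / 4) * r := by
    rw [hz, sub_add_cancel_left, norm_neg, norm_smul, Real.norm_of_nonneg ht0,
      norm_sub_rev, htD]
  have hxz : ‖x - z‖ = ‖x - y'‖ + (1 - ε / 4) * r := by
    have : x - z = (1 + t) • (x - y') := by
      rw [hz, add_smul, one_smul, show y' - x = -(x - y') by abel, smul_neg]; abel
    rw [this, norm_smul, Real.norm_of_nonneg (by linarith), add_mul, htD, one_mul]
  have hεr : 0 < ε * r := mul_pos hε hr
  have hxz' : torusDist x z = ‖x - y'‖ + (1 - ε / 4) * r := by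
    rw [torusDist_eq_norm (by rw [hxz]; nlinarith), hxz]
  refine ⟨z, disjoint_torusBall ?_, fun w hw => ⟨hw.1, ?_⟩⟩
  · rw [hxz']; nlinarith
  · have h3 := torusDist_triangle y' z w
    have h4 := torusDist_le_norm y' z
    rw [torusDist_comm y' w, hy', torusDist_add_intVec, torusDist_comm w y, ← hy'] at h3
    have := hw.2
    nlinarith

end Torus

/-! ### Multinomial laws of counts of independent points -/

lemma card_filter_coe {α : Type*} (S : Finset α) (p : α → Prop) [DecidablePred p] :
    (S.filter p).card = (Finset.univ.filter fun j : S => p j).card := by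
  rw [Finset.card_filter, Finset.card_filter, Finset.sum_coe_sort S fun j => if p j then 1 else 0]

/-- One member of an independent family is independent of the vector of finitely many others. -/
lemma indepFun_restrict {Ω E : Type*} [MeasurableSpace Ω] [MeasurableSpace E] {μ : Measure Ω}
    {X : ℕ → Ω → E} (hX : ∀ j, Measurable (X j)) (hind : iIndepFun X μ) {S : Finset ℕ} {i : ℕ}
    (hi : i ∉ S) : IndepFun (X i) (fun w (j : S) => X j w) μ :=
  (hind.indepFun_finset {i} S (by simpa using hi) hX).comp
    (φ := fun f : ({i} : Finset ℕ) → E => f ⟨i, by simp⟩) (ψ := id)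
    (measurable_pi_apply (⟨i, by simp⟩ : ({i} : Finset ℕ))) measurable_id

section Multinomial

variable {ι : Type*} [Fintype ι] [DecidableEq ι]

/-- The weight `∏ y, p y ^ c y / (c y)!`: up to the factorial of the number of points, the
probability that the cells `y` of probabilities `p y` receive the numbers `c y` of points. -/
noncomputable def multinomialWeight (p : ι → ℝ) (c : ι → ℕ) : ℝ :=
  ∏ y, p y ^ c y / (c y).factorial

lemma mul_multinomialWeight_update (p : ι → ℝ) (c : ι → ℕ) {y : ι} (hy : c y ≠ 0) :
    p y * multinomialWeight p (Function.update c y (c y - 1)) =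
      c y * multinomialWeight p c := by
  have hrest : ∏ z ∈ Finset.univ.erase y, p z ^ Function.update c y (c y - 1) z /
      (Function.update c y (c y - 1) z).factorial =
      ∏ z ∈ Finset.univ.erase y, p z ^ c z / (c z).factorial :=
    Finset.prod_congr rfl fun z hz => by
      rw [Function.update_of_ne (Finset.ne_of_mem_erase hz)]
  obtain ⟨m, hm⟩ : ∃ m, c y = m + 1 := Nat.exists_eq_succ_of_ne_zero hy
  rw [multinomialWeight, multinomialWeight, ← Finset.mul_prod_erase _ _ (Finset.mem_univ y),
    ← Finset.mul_prod_erase _ _ (Finset.mem_univ y), hrest, Function.update_self, hm,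
    Nat.add_sub_cancel, Nat.factorial_succ]
  have : (m.factorial : ℝ) ≠ 0 := by positivity
  push_cast
  field_simp
  ring

variable {Ω : Type*} [MeasurableSpace Ω] {μ : Measure Ω} [IsProbabilityMeasure μ]
  [MeasurableSpace ι] [MeasurableSingletonClass ι]

/-- The multinomial law of the occupation numbers of finitely many cells. -/
lemma measureReal_occupation_eq {Y : ℕ → Ω → ι} (hY : ∀ j, Measurable (Y j))
    (hind : iIndepFun Y μ) {p : ι → ℝ} (hp : ∀ j y, μ.real {w | Y j w = y} = p y)
    (S : Finset ℕ) (c : ι → ℕ) :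
    μ.real {w | ∀ y, (S.filter fun j => Y j w = y).card = c y} =
      if ∑ y, c y = S.card then S.card.factorial * multinomialWeight p c else 0 := by
  induction S using Finset.induction_on generalizing c with
  | empty =>
    by_cases hc : ∀ y, c y = 0
    · have : c = 0 := funext hc
      simp [this, multinomialWeight]
    · have h1 : ¬ ∑ y, c y = 0 := fun h => hc fun y => by
        simpa using (Finset.sum_eq_zero_iff.1 h) y (Finset.mem_univ y)
      have h2 : {w : Ω | ∀ y, ((∅ : Finset ℕ).filter fun j => Y j w = y).card = c y} = ∅ := by
        ext w
        simp only [Finset.filter_empty, Finset.card_empty, Set.mem_ofPred_eq,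
          Set.mem_empty_iff_false, iff_false]
        exact fun h => hc fun y => (h y).symm
      rw [h2, Finset.card_empty, if_neg h1]
      simp
  | insert i S hi ih =>
    set A : Set Ω := {w | ∀ y, ((insert i S).filter fun j => Y j w = y).card = c y} with hA
    have hcount : ∀ (w : Ω) (z : ι), ((insert i S).filter fun j => Y j w = z).card =
        (S.filter fun j => Y j w = z).card + if Y i w = z then 1 else 0 := fun w z => by
      rw [Finset.filter_insert]
      split_ifs
      · rw [Finset.card_insert_of_notMem (by simp [hi])]
      · simp
    have hterm : ∀ y, μ.real (A ∩ Y i ⁻¹' {y}) =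
        if ∑ y, c y = S.card + 1 then
          c y * (S.card.factorial * multinomialWeight p c) else 0 := by
      intro y
      by_cases hy : c y = 0
      · have : A ∩ Y i ⁻¹' {y} = ∅ := by
          refine Set.eq_empty_of_forall_notMem ?_
          rintro w ⟨hw, hwy⟩
          have := hw y
          rw [hcount, if_pos (show Y i w = y from hwy), hy] at this
          omega
        simp [this, hy]
      · set c' := Function.update c y (c y - 1) with hc'
        have h1 : A ∩ Y i ⁻¹' {y} = Y i ⁻¹' {y} ∩
            {w | ∀ z, (S.filter fun j => Y j w = z).card = c' z} := by
          ext w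
          simp only [hA, Set.mem_inter_iff, Set.mem_ofPred_eq, Set.mem_preimage,
            Set.mem_singleton_iff, hcount]
          rw [and_comm]
          refine and_congr_right fun hw => forall_congr' fun z => ?_
          rw [hw]
          by_cases hz : z = y
          · subst hz; simp only [if_true, hc', Function.update_self]; omega
          · rw [if_neg (Ne.symm hz), hc', Function.update_of_ne hz, add_zero]
        have h3 : {w | ∀ z, (S.filter fun j => Y j w = z).card = c' z} =
            (fun w (j : S) => Y j w) ⁻¹'
              {f | ∀ z, (Finset.univ.filter fun j : S => f j = z).card = c' z} := by
          ext w
          exact forall_congr' fun z => by rw [card_filter_coe]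
        have h4 : MeasurableSet {f : S → ι |
            ∀ z, (Finset.univ.filter fun j : S => f j = z).card = c' z} :=
          (Set.toFinite _).measurableSet
        rw [h1, h3, measureReal_def,
          (indepFun_restrict hY hind hi).measure_inter_preimage_eq_mul _ _
          (measurableSet_singleton y) h4, ENNReal.toReal_mul, ← h3, ← measureReal_def,
          ← measureReal_def, ih c', show μ.real (Y i ⁻¹' {y}) = p y from hp i y]
        have hsum : ∑ z, c' z + 1 = ∑ z, c z := by
          rw [← Finset.add_sum_erase _ c' (Finset.mem_univ y),
            ← Finset.add_sum_erase _ c (Finset.mem_univ y), hc', Function.update_self,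
            Finset.sum_congr rfl fun z hz =>
              Function.update_of_ne (Finset.ne_of_mem_erase hz) _ _]
          omega
        by_cases hs : ∑ y, c y = S.card + 1
        · rw [if_pos hs, if_pos (by omega), mul_left_comm,
            mul_multinomialWeight_update p c hy]
          ring
        · rw [if_neg hs, if_neg (by omega), mul_zero]
    have hsplit : μ.real A = ∑ y, μ.real (A ∩ Y i ⁻¹' {y}) := by
      have h := sum_measureReal_preimage_singleton (μ := μ.restrict A) (Finset.univ : Finset ι)
        (f := Y i) (fun y _ => hY i (measurableSet_singleton y))
      rw [Finset.coe_univ, Set.preimage_univ, measureReal_restrict_apply MeasurableSet.univ,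
        Set.univ_inter] at h
      rw [← h]
      refine Finset.sum_congr rfl fun y _ => ?_
      rw [measureReal_restrict_apply (hY i (measurableSet_singleton y)), Set.inter_comm]
    rw [hsplit, Finset.sum_congr rfl fun y _ => hterm y, Finset.card_insert_of_notMem hi]
    by_cases hs : ∑ y, c y = S.card + 1
    · simp only [if_pos hs]
      rw [← Finset.sum_mul, ← Nat.cast_sum, hs, Nat.factorial_succ]
      push_cast
      ring
    · simp [if_neg hs]

/-- The probability that, of `M` independent points, `i` fall into a cell of probability `v` and
`j` into a disjoint cell of probability `u`. The binomial coefficients vanish for `M < i + j`, where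
the exponent `M - i - j` is truncated. -/
noncomputable def trinomialTerm (M : ℕ) (v u : ℝ) (i j : ℕ) : ℝ :=
  M.choose i * (M - i).choose j * v ^ i * u ^ j * (1 - v - u) ^ (M - i - j)

/-- The probability that, of `M` independent points, fewer than `I` fall into a cell of
probability `v` and fewer than `J` into a disjoint cell of probability `u`. -/
noncomputable def trinomialCdf (M : ℕ) (v u : ℝ) (I J : ℕ) : ℝ :=
  ∑ i ∈ Finset.range I, ∑ j ∈ Finset.range J, trinomialTerm M v u i j

end Multinomial

section Trinomial

variable {Ω E : Type*} [MeasurableSpace Ω] [MeasurableSpace E] {μ : Measure Ω}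
  [IsProbabilityMeasure μ] {ρ : Measure E} {X : ℕ → Ω → E}

open Classical in
lemma measurable_card_filter_mem {X : ℕ → Ω → E} (hX : ∀ j, Measurable (X j)) (S : Finset ℕ)
    {A : Set E} (hA : MeasurableSet A) :
    Measurable fun w => (S.filter fun j => X j w ∈ A).card := by
  simp_rw [Finset.card_filter]
  exact Finset.measurable_sum _ fun j _ =>
    Measurable.ite (hX j hA) measurable_const measurable_const

open Classical in
/-- The trinomial law, from the multinomial one for the three cells `A`, `C` and `(A ∪ C)ᶜ`. -/
lemma measureReal_card_eq_card_eq (hX : ∀ j, Measurable (X j))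
    (hlaw : ∀ j, HasLaw (X j) ρ μ) (hind : iIndepFun X μ) {A C : Set E} (hA : MeasurableSet A)
    (hC : MeasurableSet C) (hAC : Disjoint A C) (S : Finset ℕ) (i j : ℕ) :
    μ.real {w | (S.filter fun l => X l w ∈ A).card = i ∧ (S.filter fun l => X l w ∈ C).card = j} =
      trinomialTerm S.card (ρ.real A) (ρ.real C) i j := by
  let ℓ : E → Fin 3 := fun x => if x ∈ A then 0 else if x ∈ C then 1 else 2
  have hℓ : Measurable ℓ :=
    Measurable.ite hA measurable_const (Measurable.ite hC measurable_const measurable_const)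
  have h0 : ∀ x, ℓ x = 0 ↔ x ∈ A := fun x => by
    simp only [ℓ]; split_ifs <;> simp_all
  have h1 : ∀ x, ℓ x = 1 ↔ x ∈ C := fun x => by
    have : x ∈ A → x ∉ C := fun h => Set.disjoint_left.1 hAC h
    simp only [ℓ]; split_ifs <;> simp_all
  have h2 : ∀ x, ℓ x = 2 ↔ x ∈ (A ∪ C)ᶜ := fun x => by
    simp only [ℓ]; split_ifs <;> simp_all
  have hρ : IsProbabilityMeasure ρ := (hlaw 0).isProbabilityMeasure_iff.1 inferInstance
  have hpre : ∀ (l : ℕ) (B : Set E), MeasurableSet B → μ.real {w | X l w ∈ B} = ρ.real B :=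
    fun l B hB => (hlaw l).measureReal_eq hB
  have hp : ∀ (l : ℕ) (y : Fin 3), μ.real {w | (ℓ ∘ X l) w = y} =
      ![ρ.real A, ρ.real C, 1 - ρ.real A - ρ.real C] y := by
    intro l y
    fin_cases y
    · simpa [h0] using hpre l A hA
    · simpa [h1] using hpre l C hC
    · have := hpre l (A ∪ C)ᶜ (hA.union hC).compl
      rw [probReal_compl_eq_one_sub (hA.union hC), measureReal_union hAC hC] at this
      simp only [Function.comp_apply, Fin.reduceFinMk, h2, Matrix.cons_val]
      rw [this]; ring
  have hsum : ∀ w, (S.filter fun l => ℓ (X l w) = 0).card +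
      (S.filter fun l => ℓ (X l w) = 1).card + (S.filter fun l => ℓ (X l w) = 2).card =
        S.card := fun w => by
    have h := Finset.card_eq_sum_card_fiberwise (s := S) (f := fun l => ℓ (X l w))
      (t := Finset.univ) (fun _ _ => Finset.mem_coe.2 (Finset.mem_univ _))
    rw [Fin.sum_univ_three] at h
    exact h.symm
  have hset : {w | (S.filter fun l => X l w ∈ A).card = i ∧
      (S.filter fun l => X l w ∈ C).card = j} =
      {w | (S.filter fun l => ℓ (X l w) = 0).card = i ∧
        (S.filter fun l => ℓ (X l w) = 1).card = j} := by
    simp only [h0, h1]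
  rw [hset, trinomialTerm]
  by_cases hij : i + j ≤ S.card
  · have hset2 : {w | (S.filter fun l => ℓ (X l w) = 0).card = i ∧
        (S.filter fun l => ℓ (X l w) = 1).card = j} =
        {w | ∀ y, (S.filter fun l => (ℓ ∘ X l) w = y).card = ![i, j, S.card - i - j] y} := by
      ext w
      have := hsum w
      simp only [Set.mem_ofPred_eq, Fin.forall_fin_succ, Function.comp_apply]
      simp
      omega
    rw [hset2, measureReal_occupation_eq (fun l => hℓ.comp (hX l))
      (hind.comp _ fun _ => hℓ) hp, if_pos (by simp [Fin.sum_univ_three]; omega),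
      multinomialWeight, Fin.prod_univ_three, Nat.cast_choose ℝ (by omega : i ≤ S.card),
      Nat.cast_choose ℝ (by omega : j ≤ S.card - i)]
    have f1 : (((S.card - i).factorial : ℕ) : ℝ) ≠ 0 := by positivity
    simp only [Matrix.cons_val]
    field_simp
  · have hset2 : {w | (S.filter fun l => ℓ (X l w) = 0).card = i ∧
        (S.filter fun l => ℓ (X l w) = 1).card = j} = ∅ := by
      ext w
      have := hsum w
      simp only [Set.mem_ofPred_eq, Set.mem_empty_iff_false, iff_false]
      omega
    rw [hset2]
    rcases lt_or_ge S.card i with h | h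
    · simp [Nat.choose_eq_zero_of_lt h]
    · simp [Nat.choose_eq_zero_of_lt (show S.card - i < j by omega)]

open Classical in
lemma measureReal_card_lt_card_lt (hX : ∀ j, Measurable (X j))
    (hlaw : ∀ j, HasLaw (X j) ρ μ) (hind : iIndepFun X μ) {A C : Set E} (hA : MeasurableSet A)
    (hC : MeasurableSet C) (hAC : Disjoint A C) (S : Finset ℕ) (I J : ℕ) :
    μ.real {w | (S.filter fun l => X l w ∈ A).card < I ∧ (S.filter fun l => X l w ∈ C).card < J} =
      trinomialCdf S.card (ρ.real A) (ρ.real C) I J := by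
  have hset : {w | (S.filter fun l => X l w ∈ A).card < I ∧
      (S.filter fun l => X l w ∈ C).card < J} =
      (fun w => ((S.filter fun l => X l w ∈ A).card, (S.filter fun l => X l w ∈ C).card)) ⁻¹'
        ((Finset.range I ×ˢ Finset.range J : Finset (ℕ × ℕ)) : Set (ℕ × ℕ)) := by
    ext w; simp
  have hm := (measurable_card_filter_mem hX S hA).prodMk (measurable_card_filter_mem hX S hC)
  rw [hset, ← sum_measureReal_preimage_singleton _ fun y _ => hm (measurableSet_singleton y),
    trinomialCdf, Finset.sum_product]
  refine Finset.sum_congr rfl fun i _ => Finset.sum_congr rfl fun j _ => ?_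
  rw [← measureReal_card_eq_card_eq hX hlaw hind hA hC hAC]
  congr 1
  ext w
  simp

open Classical in
lemma measureReal_card_lt (hX : ∀ j, Measurable (X j))
    (hlaw : ∀ j, HasLaw (X j) ρ μ) (hind : iIndepFun X μ) {A : Set E} (hA : MeasurableSet A)
    (S : Finset ℕ) (I : ℕ) :
    μ.real {w | (S.filter fun l => X l w ∈ A).card < I} =
      trinomialCdf S.card (ρ.real A) 0 I 1 := by
  have h := measureReal_card_lt_card_lt hX hlaw hind hA MeasurableSet.empty
    (Set.disjoint_empty A) S I 1
  simpa using h

end Trinomial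

/-! ### Moment bounds for the binomial process -/

section Binomial

variable {Ω : Type*} [MeasurableSpace Ω] {μ : Measure Ω} [IsProbabilityMeasure μ]

/-- Fubini's theorem for the probability of an event that depends on two independent random
elements. -/
lemma measure_prodMk_mem_eq_lintegral {E F : Type*} [MeasurableSpace E] [MeasurableSpace F]
    {ρ : Measure E} {U : Ω → E} {V : Ω → F} (hU : HasLaw U ρ μ) (hV : Measurable V)
    (hUV : IndepFun U V μ) {G : Set (E × F)} (hG : MeasurableSet G) :
    μ {w | (U w, V w) ∈ G} = ∫⁻ x, μ {w | (x, V w) ∈ G} ∂ρ := by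
  have hmap := (indepFun_iff_map_prod_eq_prod_map_map hU.aemeasurable hV.aemeasurable).1 hUV
  have h1 : μ {w | (U w, V w) ∈ G} = μ.map (fun w => (U w, V w)) G :=
    (Measure.map_apply_of_aemeasurable (hU.aemeasurable.prodMk hV.aemeasurable) hG).symm
  have : IsProbabilityMeasure (μ.map V) := Measure.isProbabilityMeasure_map hV.aemeasurable
  rw [h1, hmap, Measure.prod_apply hG, hU.map_eq]
  refine lintegral_congr fun x => ?_
  rw [Measure.map_apply hV (measurable_prodMk_left hG)]
  rfl

lemma measure_prodMk_prodMk_mem_eq_lintegral {E : Type*} [MeasurableSpace E] {ρ : Measure E}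
    {X : ℕ → Ω → E} (hX : ∀ j, Measurable (X j)) (hlaw : ∀ j, HasLaw (X j) ρ μ)
    (hind : iIndepFun X μ) {S : Finset ℕ} {i j : ℕ} (hij : i ≠ j) (hi : i ∉ S) (hj : j ∉ S)
    {G : Set ((E × E) × (S → E))} (hG : MeasurableSet G) :
    μ {w | ((X i w, X j w), fun l : S => X l w) ∈ G} =
      ∫⁻ x, ∫⁻ y, μ {w | ((x, y), fun l : S => X l w) ∈ G} ∂ρ ∂ρ := by
  have hρ : IsProbabilityMeasure ρ := (hlaw 0).isProbabilityMeasure_iff.1 inferInstance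
  have hV : Measurable fun w (l : S) => X l w := measurable_pi_lambda _ fun l => hX l
  have hU : HasLaw (fun w => (X i w, X j w)) (ρ.prod ρ) μ :=
    ⟨((hX i).prodMk (hX j)).aemeasurable, by
      rw [(indepFun_iff_map_prod_eq_prod_map_map (hX i).aemeasurable (hX j).aemeasurable).1
        (hind.indepFun hij), (hlaw i).map_eq, (hlaw j).map_eq]⟩
  have hd : Disjoint ({i, j} : Finset ℕ) S := by
    simp [hi, hj]
  have hUV : IndepFun (fun w => (X i w, X j w)) (fun w (l : S) => X l w) μ :=
    (hind.indepFun_finset {i, j} S hd hX).comp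
      (φ := fun f : ({i, j} : Finset ℕ) → E => (f ⟨i, by simp⟩, f ⟨j, by simp⟩)) (ψ := id)
      ((measurable_pi_apply (⟨i, by simp⟩ : ({i, j} : Finset ℕ))).prodMk
        (measurable_pi_apply (⟨j, by simp⟩ : ({i, j} : Finset ℕ)))) measurable_id
  rw [measure_prodMk_mem_eq_lintegral hU hV hUV hG, lintegral_prod]
  have : IsProbabilityMeasure (μ.map fun w (l : S) => X l w) :=
    Measure.isProbabilityMeasure_map hV.aemeasurable
  have h : ∀ p : E × E, μ {w | (p, fun l : S => X l w) ∈ G} =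
      (μ.map fun w (l : S) => X l w) (Prod.mk p ⁻¹' G) := fun p => by
    rw [Measure.map_apply hV (measurable_prodMk_left hG)]; rfl
  simp_rw [h]
  exact (measurable_measure_prodMk_left hG).aemeasurable

/-- The second Bonferroni inequality, for a uniform bound on the pairwise intersections. -/
lemma sum_sub_le_measureReal_biUnion {D : ℕ → Set Ω} (hD : ∀ i, MeasurableSet (D i)) {q : ℝ}
    (hq0 : 0 ≤ q) (S : Finset ℕ)
    (hq : ∀ i ∈ S, ∀ j ∈ S, i ≠ j → μ.real (D i ∩ D j) ≤ q) :
    ∑ i ∈ S, μ.real (D i) - S.card * (S.card - 1) * q ≤ μ.real (⋃ i ∈ S, D i) := by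
  induction S using Finset.induction_on with
  | empty => simp
  | insert i S hi ih =>
    have ih' := ih fun a ha b hb => hq a (Finset.mem_insert_of_mem ha) b
      (Finset.mem_insert_of_mem hb)
    have hU : MeasurableSet (⋃ j ∈ S, D j) := Finset.measurableSet_biUnion _ fun j _ => hD j
    have h1 := measureReal_union_add_inter (μ := μ) (s := D i) hU (measure_ne_top _ _)
      (measure_ne_top _ _)
    have h2 : μ.real (D i ∩ ⋃ j ∈ S, D j) ≤ S.card * q := by
      rw [Set.inter_iUnion₂]
      refine (measureReal_biUnion_finset_le _ _).trans ?_
      rw [← nsmul_eq_mul]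
      refine Finset.sum_le_card_nsmul _ _ _ fun j hj => hq i (Finset.mem_insert_self _ _) j
        (Finset.mem_insert_of_mem hj) ?_
      rintro rfl
      exact hi hj
    rw [Finset.set_biUnion_insert, Finset.sum_insert hi, Finset.card_insert_of_notMem hi]
    have h3 : (0 : ℝ) ≤ S.card * q := by positivity
    push_cast
    nlinarith

variable {d : ℕ}

lemma one_le_lowDegreeCount_iff {k : ℕ} {r : ℝ} {ω : Multiset (EuclideanSpace ℝ (Fin d))} :
    1 ≤ lowDegreeCount k r ω ↔ ∃ x ∈ ω, count ω (torusBall x r) ≤ k := by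
  classical
  rw [lowDegreeCount, Nat.one_le_iff_ne_zero, ← Nat.pos_iff_ne_zero]
  exact Multiset.countP_pos

open Classical in
lemma count_binomialProcess {Ω E : Type*} (X : ℕ → Ω → E) (m : ℕ) (w : Ω) (A : Set E) :
    count (binomialProcess X m w) A = ((Finset.range m).filter fun j => X j w ∈ A).card := by
  rw [count, binomialProcess, Multiset.countP_map]
  rfl

open Classical in
lemma setOf_one_le_lowDegreeCount_binomialProcess {Ω : Type*} (X : ℕ → Ω → EuclideanSpace ℝ (Fin d))
    (k m : ℕ) (r : ℝ) :
    {w | 1 ≤ lowDegreeCount k r (binomialProcess X m w)} = ⋃ i ∈ Finset.range m,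
      {w | ((Finset.range m).filter fun j => X j w ∈ torusBall (X i w) r).card ≤ k} := by
  ext w
  simp only [Set.mem_ofPred_eq, one_le_lowDegreeCount_iff, count_binomialProcess, Set.mem_iUnion,
    exists_prop]
  simp [binomialProcess]

lemma measurableSet_mem_torusBall (r : ℝ) :
    MeasurableSet {p : EuclideanSpace ℝ (Fin d) × EuclideanSpace ℝ (Fin d) |
      p.2 ∈ torusBall p.1 r} :=
  (measurable_snd measurableSet_unitCube).inter (measurable_torusDist measurableSet_Iic)

open Classical in
lemma measurable_card_filter_mem_torusBall {α ι : Type*} [MeasurableSpace α] (S : Finset ι)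
    {f : α → EuclideanSpace ℝ (Fin d)} {g : ι → α → EuclideanSpace ℝ (Fin d)} (hf : Measurable f)
    (hg : ∀ i, Measurable (g i)) (r : ℝ) :
    Measurable fun a => (S.filter fun i => g i a ∈ torusBall (f a) r).card := by
  simp_rw [Finset.card_filter]
  exact Finset.measurable_sum _ fun j _ =>
    Measurable.ite ((hf.prodMk (hg j)) (measurableSet_mem_torusBall r)) measurable_const
      measurable_const

lemma measureReal_torusBall (x : EuclideanSpace ℝ (Fin d)) {r : ℝ} (h0 : 0 ≤ r)
    (hr : r < 1 / 2) : (cubeMeasure d).real (torusBall x r) = r ^ d * theta d := by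
  rw [measureReal_def, cubeMeasure_torusBall x h0 hr, ENNReal.toReal_ofReal]
  exact mul_nonneg (by positivity) theta_nonneg

lemma ae_mem_unitCube : ∀ᵐ x ∂cubeMeasure d, x ∈ unitCube d :=
  ae_restrict_mem measurableSet_unitCube

lemma ae_mem_unitCube_of_hasLaw {Ω : Type*} [MeasurableSpace Ω] {μ : Measure Ω}
    {U : Ω → EuclideanSpace ℝ (Fin d)}
    (hU : HasLaw U (cubeMeasure d) μ) : ∀ᵐ w ∂μ, U w ∈ unitCube d :=
  (hU.ae_iff measurableSet_unitCube.mem).2 ae_mem_unitCube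

lemma trinomialTerm_nonneg {M : ℕ} {v u : ℝ} (hv : 0 ≤ v) (hu : 0 ≤ u) (hvu : v + u ≤ 1)
    (i j : ℕ) : 0 ≤ trinomialTerm M v u i j := by
  have : 0 ≤ 1 - v - u := by linarith
  unfold trinomialTerm
  positivity

lemma trinomialCdf_nonneg {M : ℕ} {v u : ℝ} (hv : 0 ≤ v) (hu : 0 ≤ u) (hvu : v + u ≤ 1)
    (I J : ℕ) : 0 ≤ trinomialCdf M v u I J :=
  Finset.sum_nonneg fun _ _ => Finset.sum_nonneg fun _ _ => trinomialTerm_nonneg hv hu hvu _ _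

/-- A bound for the probability that two given points of a binomial process with `M` further
points both have at most `k` points in their balls of volume `v`. The three summands correspond to
pairs at distance more than `2 r`, between `ε r` and `2 r`, and less than `ε r`. In the last case
each of the two points lies in the ball of the other, so that one point less
is allowed; for `k = 1` the truncated `k - 1 = 0` then leaves an empty event. -/
noncomputable def pairBound (d k : ℕ) (ε v : ℝ) (M : ℕ) : ℝ :=
  trinomialCdf M v v k k + 2 ^ d * v * trinomialCdf M v ((ε / 4) ^ d * v) k k +
    ε ^ d * v * trinomialCdf M v 0 (k - 1) 1

lemma pairBound_summands_nonneg (d k M : ℕ) {ε v : ℝ} (hε : 0 ≤ ε) (hε1 : ε ≤ 1) (hv : 0 ≤ v)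
    (hv2 : 2 * v ≤ 1) :
    0 ≤ trinomialCdf M v v k k ∧ 0 ≤ trinomialCdf M v ((ε / 4) ^ d * v) k k ∧
      0 ≤ trinomialCdf M v 0 (k - 1) 1 := by
  have h : (ε / 4) ^ d ≤ 1 := pow_le_one₀ (by positivity) (by linarith)
  exact ⟨trinomialCdf_nonneg hv hv (by linarith) _ _,
    trinomialCdf_nonneg hv (by positivity) (by nlinarith) _ _,
    trinomialCdf_nonneg hv le_rfl (by linarith) _ _⟩

lemma pairBound_nonneg (d k M : ℕ) {ε v : ℝ} (hε : 0 ≤ ε) (hε1 : ε ≤ 1) (hv : 0 ≤ v)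
    (hv2 : 2 * v ≤ 1) : 0 ≤ pairBound d k ε v M := by
  obtain ⟨n1, n2, n3⟩ := pairBound_summands_nonneg d k M hε hε1 hv hv2
  unfold pairBound
  positivity

/-- In positive dimension, a ball of twice the radius still embeds into the torus. -/
lemma two_mul_volume_le_one (hd : 1 ≤ d) {r : ℝ} (hr : 0 < r) (hr2 : r ≤ 1 / 6) :
    2 * (r ^ d * theta d) ≤ 1 := by
  have h : (cubeMeasure d).real (torusBall 0 (2 * r)) ≤ 1 := measureReal_le_one
  rw [measureReal_torusBall 0 (by positivity) (by linarith), mul_pow, mul_assoc] at h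
  have h2 : (2 : ℝ) ≤ 2 ^ d := le_self_pow₀ one_le_two (by omega)
  have h3 : 0 ≤ r ^ d * theta d := mul_nonneg (by positivity) theta_nonneg
  nlinarith

variable {X : ℕ → Ω → EuclideanSpace ℝ (Fin d)}

open Classical in
/-- The point `X i` lies in its own ball, so that it has degree at most `k` exactly when fewer than
`k` of the other points lie in that ball. -/
lemma measureReal_card_le_eq (hX : ∀ j, Measurable (X j))
    (hlaw : ∀ j, HasLaw (X j) (cubeMeasure d) μ) (hind : iIndepFun X μ) (k : ℕ) {r : ℝ}
    (hr : 0 ≤ r) (hr2 : r < 1 / 2) {m i : ℕ} (hi : i ∈ Finset.range m) :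
    μ.real {w | ((Finset.range m).filter fun j => X j w ∈ torusBall (X i w) r).card ≤ k} =
      trinomialCdf (m - 1) (r ^ d * theta d) 0 k 1 := by
  set S := (Finset.range m).erase i with hS
  have hiS : i ∉ S := Finset.notMem_erase _ _
  have hcard : S.card = m - 1 := by rw [hS, Finset.card_erase_of_mem hi, Finset.card_range]
  set G : Set (EuclideanSpace ℝ (Fin d) × (S → EuclideanSpace ℝ (Fin d))) :=
    {p | (Finset.univ.filter fun l : S => p.2 l ∈ torusBall p.1 r).card < k} with hG
  have hGm : MeasurableSet G :=
    measurable_card_filter_mem_torusBall _ measurable_fst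
      (fun l => (measurable_pi_apply l).comp measurable_snd) r measurableSet_Iio
  have h1 : {w | ((Finset.range m).filter fun j => X j w ∈ torusBall (X i w) r).card ≤ k} =ᵐ[μ]
      {w | (X i w, fun l : S => X l w) ∈ G} := by
    filter_upwards [ae_mem_unitCube_of_hasLaw (hlaw i)] with w hw
    refine propext ?_
    change _ ≤ k ↔ _ < k
    rw [← Finset.insert_erase hi, Finset.filter_insert,
      if_pos (mem_torusBall_self hw hr), Finset.card_insert_of_notMem (by simp),
      ← card_filter_coe S fun l => X l w ∈ torusBall (X i w) r, Nat.succ_le_iff]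
  rw [measureReal_congr h1, measureReal_def, measure_prodMk_mem_eq_lintegral (hlaw i)
    (measurable_pi_lambda _ fun l : S => hX l) (indepFun_restrict hX hind hiS) hGm]
  have h2 : ∀ x, μ {w | (x, fun l : S => X l w) ∈ G} =
      ENNReal.ofReal (trinomialCdf (m - 1) (r ^ d * theta d) 0 k 1) := fun x => by
    rw [← measureReal_torusBall x hr hr2, ← hcard,
      ← measureReal_card_lt hX hlaw hind (measurableSet_torusBall x r), ofReal_measureReal]
    congr 1
    ext w
    exact iff_of_eq (congrArg (· < k)
      (card_filter_coe S fun l => X l w ∈ torusBall x r).symm)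
  simp_rw [h2]
  rw [lintegral_const, measure_univ, mul_one, ENNReal.toReal_ofReal]
  have hle : (cubeMeasure d).real (torusBall 0 r) ≤ 1 := measureReal_le_one
  rw [measureReal_torusBall 0 hr hr2] at hle
  exact trinomialCdf_nonneg (mul_nonneg (by positivity) theta_nonneg) le_rfl (by linarith) _ _

open Classical in
/-- The bound behind `pairBound` for fixed positions `x` and `y` of the two points, whose three
cases appear as summands supported on nested balls around `x`. -/
lemma measure_pair_le (hX : ∀ j, Measurable (X j))
    (hlaw : ∀ j, HasLaw (X j) (cubeMeasure d) μ) (hind : iIndepFun X μ) (k : ℕ) {r : ℝ}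
    (hr : 0 < r) (hr2 : r ≤ 1 / 6) {ε : ℝ} (hε : 0 < ε) (hε1 : ε ≤ 1) (S : Finset ℕ)
    {x y : EuclideanSpace ℝ (Fin d)} (hy : y ∈ unitCube d) :
    μ {w | (S.filter fun l => X l w ∈ torusBall x r).card + (if y ∈ torusBall x r then 1 else 0) < k
      ∧ (S.filter fun l => X l w ∈ torusBall y r).card < k} ≤
    ENNReal.ofReal (trinomialCdf S.card (r ^ d * theta d) (r ^ d * theta d) k k) +
    (torusBall x (2 * r)).indicator (fun _ => ENNReal.ofReal
      (trinomialCdf S.card (r ^ d * theta d) ((ε / 4) ^ d * (r ^ d * theta d)) k k)) y +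
    (torusBall x (ε * r)).indicator (fun _ => ENNReal.ofReal
      (trinomialCdf S.card (r ^ d * theta d) 0 (k - 1) 1)) y := by
  have hv : ∀ z, (cubeMeasure d).real (torusBall z r) = r ^ d * theta d := fun z =>
    measureReal_torusBall z hr.le (by linarith)
  have hm := fun (z : EuclideanSpace ℝ (Fin d)) (ρ : ℝ) => measurableSet_torusBall z ρ
  by_cases h1 : y ∈ torusBall x (ε * r)
  · have h1' : y ∈ torusBall x r := ⟨h1.1, h1.2.trans (by nlinarith)⟩
    refine le_trans ?_ le_add_self
    rw [Set.indicator_of_mem h1, ← hv x, ← measureReal_card_lt hX hlaw hind (hm x r),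
      ofReal_measureReal]
    refine measure_mono fun w hw => ?_
    have := hw.1
    rw [if_pos h1'] at this
    exact Nat.lt_sub_of_add_lt this
  have hD : ε * r ≤ torusDist x y := by
    by_contra h
    exact h1 ⟨hy, (not_le.1 h).le⟩
  by_cases h2 : y ∈ torusBall x (2 * r)
  · obtain ⟨z, hz1, hz2⟩ := exists_torusBall_subset_disjoint hr hε hε1 hr2 hD h2.2
    refine le_trans ?_ (le_add_right le_add_self)
    have hz : (cubeMeasure d).real (torusBall z (ε / 4 * r)) =
        (ε / 4) ^ d * (r ^ d * theta d) := by
      rw [measureReal_torusBall z (by positivity) (by nlinarith), mul_pow, mul_assoc]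
    rw [Set.indicator_of_mem h2, ← hz, ← hv x,
      ← measureReal_card_lt_card_lt hX hlaw hind (hm x r) (hm z _) hz1, ofReal_measureReal]
    refine measure_mono fun w hw => ⟨lt_of_le_of_lt (Nat.le_add_right _ _) hw.1,
      lt_of_le_of_lt (Finset.card_le_card ?_) hw.2⟩
    exact Finset.monotone_filter_right _ fun l _ hl => hz2 hl
  · have hD2 : 2 * r < torusDist x y := by
      by_contra h
      exact h2 ⟨hy, not_lt.1 h⟩
    refine le_trans ?_ (le_add_right le_self_add)
    have h3 := measureReal_card_lt_card_lt hX hlaw hind (hm x r) (hm y r)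
      (disjoint_torusBall (by linarith)) S k k
    rw [hv x, hv y] at h3
    rw [← h3, ofReal_measureReal]
    exact measure_mono fun w hw => ⟨lt_of_le_of_lt (Nat.le_add_right _ _) hw.1, hw.2⟩

open Classical in
lemma measureReal_inter_le_pairBound (hX : ∀ j, Measurable (X j))
    (hlaw : ∀ j, HasLaw (X j) (cubeMeasure d) μ) (hind : iIndepFun X μ) (hd : 1 ≤ d) (k : ℕ) {r : ℝ}
    (hr : 0 < r) (hr2 : r ≤ 1 / 6) {ε : ℝ} (hε : 0 < ε) (hε1 : ε ≤ 1) {m i j : ℕ}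
    (hi : i ∈ Finset.range m) (hj : j ∈ Finset.range m) (hij : i ≠ j) :
    μ.real ({w | ((Finset.range m).filter fun l => X l w ∈ torusBall (X i w) r).card ≤ k} ∩
      {w | ((Finset.range m).filter fun l => X l w ∈ torusBall (X j w) r).card ≤ k}) ≤
      pairBound d k ε (r ^ d * theta d) (m - 2) := by
  set v := r ^ d * theta d with hv
  have hball : ∀ (x : EuclideanSpace ℝ (Fin d)) (t : ℝ), 0 ≤ t → t ≤ 2 →
      (cubeMeasure d) (torusBall x (t * r)) = ENNReal.ofReal (t ^ d * v) := fun x t ht ht2 => by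
    rw [cubeMeasure_torusBall x (by positivity) (by nlinarith), hv, mul_pow, mul_assoc]
  have hv0 : 0 ≤ v := mul_nonneg (by positivity) theta_nonneg
  have hv2 : 2 * v ≤ 1 := two_mul_volume_le_one hd hr hr2
  set S := ((Finset.range m).erase i).erase j with hS
  have hji : j ∈ (Finset.range m).erase i := Finset.mem_erase.2 ⟨hij.symm, hj⟩
  have hjS : j ∉ S := Finset.notMem_erase _ _
  have hiS : i ∉ S := fun h => Finset.notMem_erase i _ (Finset.mem_of_mem_erase h)
  have hcard : S.card = m - 2 := by
    rw [hS, Finset.card_erase_of_mem hji, Finset.card_erase_of_mem hi, Finset.card_range]; rfl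
  have hins : Finset.range m = insert i (insert j S) := by
    rw [hS, Finset.insert_erase hji, Finset.insert_erase hi]
  set G : Set ((EuclideanSpace ℝ (Fin d) × EuclideanSpace ℝ (Fin d)) ×
      (S → EuclideanSpace ℝ (Fin d))) :=
    {p | (Finset.univ.filter fun l : S => p.2 l ∈ torusBall p.1.1 r).card +
      (if p.1.2 ∈ torusBall p.1.1 r then 1 else 0) < k ∧
      (Finset.univ.filter fun l : S => p.2 l ∈ torusBall p.1.2 r).card < k} with hG
  have hGm : MeasurableSet G := by
    refine MeasurableSet.inter ?_ ?_
    · refine (measurable_card_filter_mem_torusBall Finset.univ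
        (f := fun p : (EuclideanSpace ℝ (Fin d) × EuclideanSpace ℝ (Fin d)) ×
          (S → EuclideanSpace ℝ (Fin d)) => p.1.1) (g := fun l p => p.2 l)
        (by fun_prop) (fun l => by fun_prop) r).add ?_ measurableSet_Iio
      exact Measurable.ite (measurable_fst (measurableSet_mem_torusBall r)) measurable_const
        measurable_const
    · exact measurable_card_filter_mem_torusBall Finset.univ
        (f := fun p : (EuclideanSpace ℝ (Fin d) × EuclideanSpace ℝ (Fin d)) ×
          (S → EuclideanSpace ℝ (Fin d)) => p.1.2) (g := fun l p => p.2 l)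
        (by fun_prop) (fun l => by fun_prop) r measurableSet_Iio
  have h1 : ∀ᵐ w ∂μ, (w ∈ {w | ((Finset.range m).filter fun l =>
      X l w ∈ torusBall (X i w) r).card ≤ k} ∩
      {w | ((Finset.range m).filter fun l => X l w ∈ torusBall (X j w) r).card ≤ k}) →
      w ∈ {w | ((X i w, X j w), fun l : S => X l w) ∈ G} := by
    filter_upwards [ae_mem_unitCube_of_hasLaw (hlaw i), ae_mem_unitCube_of_hasLaw (hlaw j)]
      with w hwi hwj hw
    obtain ⟨hw1, hw2⟩ := hw
    simp only [Set.mem_ofPred_eq, hins] at hw1 hw2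
    rw [Finset.filter_insert, if_pos (mem_torusBall_self hwi hr.le),
      Finset.card_insert_of_notMem (by simp [hij, hiS]), Finset.filter_insert] at hw1
    have hw3 : (insert j (S.filter fun l => X l w ∈ torusBall (X j w) r)).card ≤ k := by
      refine le_trans (Finset.card_le_card fun l hl => ?_) hw2
      rcases Finset.mem_insert.1 hl with rfl | hl
      · exact Finset.mem_filter.2 ⟨by simp, mem_torusBall_self hwj hr.le⟩
      · obtain ⟨hl1, hl2⟩ := Finset.mem_filter.1 hl
        exact Finset.mem_filter.2 ⟨by simp [hl1], hl2⟩
    rw [Finset.card_insert_of_notMem (by simp [hjS])] at hw3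
    refine ⟨?_, ?_⟩
    · change (Finset.univ.filter fun l : S => X l w ∈ torusBall (X i w) r).card +
        (if X j w ∈ torusBall (X i w) r then 1 else 0) < k
      rw [← card_filter_coe S fun l => X l w ∈ torusBall (X i w) r]
      split_ifs at hw1 ⊢ with h
      · rw [Finset.card_insert_of_notMem (by simp [hjS])] at hw1
        omega
      · omega
    · change (Finset.univ.filter fun l : S => X l w ∈ torusBall (X j w) r).card < k
      rw [← card_filter_coe S fun l => X l w ∈ torusBall (X j w) r]
      omega
  obtain ⟨n1, n2, n3⟩ := pairBound_summands_nonneg d k (m - 2) hε.le hε1 hv0 hv2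
  rw [measureReal_def]
  refine ENNReal.toReal_le_of_le_ofReal (pairBound_nonneg d k _ hε.le hε1 hv0 hv2) ?_
  refine (measure_mono_ae (t := {w | ((X i w, X j w), fun l : S => X l w) ∈ G}) h1).trans ?_
  rw [measure_prodMk_prodMk_mem_eq_lintegral hX hlaw hind hij hiS hjS hGm]
  have hinner : ∀ x, ∫⁻ y, μ {w | ((x, y), fun l : S => X l w) ∈ G} ∂cubeMeasure d ≤
      ENNReal.ofReal (pairBound d k ε v (m - 2)) := by
    intro x
    have hle : ∀ᵐ y ∂cubeMeasure d, μ {w | ((x, y), fun l : S => X l w) ∈ G} ≤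
        ENNReal.ofReal (trinomialCdf (m - 2) v v k k) +
        (torusBall x (2 * r)).indicator (fun _ => ENNReal.ofReal
          (trinomialCdf (m - 2) v ((ε / 4) ^ d * v) k k)) y +
        (torusBall x (ε * r)).indicator (fun _ => ENNReal.ofReal
          (trinomialCdf (m - 2) v 0 (k - 1) 1)) y := by
      filter_upwards [ae_mem_unitCube] with y hy
      refine le_trans (le_of_eq ?_) ((measure_pair_le hX hlaw hind k hr hr2 hε hε1 S
        (x := x) hy).trans_eq (by rw [hcard]))
      congr 1
      ext w
      change _ ∧ _ ↔ _ ∧ _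
      rw [card_filter_coe S fun l => X l w ∈ torusBall x r,
        card_filter_coe S fun l => X l w ∈ torusBall y r]
    refine (lintegral_mono_ae hle).trans ?_
    rw [lintegral_add_right _ (measurable_const.indicator (measurableSet_torusBall _ _)),
      lintegral_add_right _ (measurable_const.indicator (measurableSet_torusBall _ _)),
      lintegral_const, measure_univ, mul_one,
      lintegral_indicator_const (measurableSet_torusBall _ _),
      lintegral_indicator_const (measurableSet_torusBall _ _), hball x 2 (by norm_num) le_rfl,
      hball x ε hε.le (by linarith), ← ENNReal.ofReal_mul n2, ← ENNReal.ofReal_mul n3,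
      ← ENNReal.ofReal_add n1 (by positivity), ← ENNReal.ofReal_add (by positivity)
      (by positivity), pairBound, mul_comm (2 ^ d * v), mul_comm (ε ^ d * v)]
  refine (lintegral_mono hinner).trans ?_
  rw [lintegral_const, measure_univ, mul_one]

open Classical in
/-- First and second moment bounds for the probability that some point of the binomial process has
a low degree. -/
theorem binomial_probability_bounds (hX : ∀ j, Measurable (X j))
    (hlaw : ∀ j, HasLaw (X j) (cubeMeasure d) μ) (hind : iIndepFun X μ) (hd : 1 ≤ d) (k : ℕ) {r : ℝ}
    (hr : 0 < r) (hr2 : r ≤ 1 / 6) {ε : ℝ} (hε : 0 < ε) (hε1 : ε ≤ 1) (m : ℕ) :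
    μ.real {w | 1 ≤ lowDegreeCount k r (binomialProcess X m w)} ≤
        m * trinomialCdf (m - 1) (r ^ d * theta d) 0 k 1 ∧
      m * trinomialCdf (m - 1) (r ^ d * theta d) 0 k 1 -
          m * (m - 1) * pairBound d k ε (r ^ d * theta d) (m - 2) ≤
        μ.real {w | 1 ≤ lowDegreeCount k r (binomialProcess X m w)} := by
  have hD : ∀ i, MeasurableSet {w | ((Finset.range m).filter fun j =>
      X j w ∈ torusBall (X i w) r).card ≤ k} := fun i =>
    measurable_card_filter_mem_torusBall _ (hX i) hX r measurableSet_Iic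
  have hsum : ∑ i ∈ Finset.range m, μ.real {w | ((Finset.range m).filter fun j =>
      X j w ∈ torusBall (X i w) r).card ≤ k} =
        m * trinomialCdf (m - 1) (r ^ d * theta d) 0 k 1 := by
    rw [Finset.sum_congr rfl fun i hi => measureReal_card_le_eq hX hlaw hind k hr.le
      (by linarith) hi]
    simp
  rw [setOf_one_le_lowDegreeCount_binomialProcess, ← hsum]
  refine ⟨measureReal_biUnion_finset_le _ _, ?_⟩
  have h := sum_sub_le_measureReal_biUnion (μ := μ) hD
    (q := pairBound d k ε (r ^ d * theta d) (m - 2)) ?_ (Finset.range m)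
    fun i hi j hj hij => measureReal_inter_le_pairBound hX hlaw hind hd k hr hr2 hε hε1 hi hj hij
  · simpa using h
  · exact pairBound_nonneg d k _ hε.le hε1 (mul_nonneg (by positivity) theta_nonneg)
      (two_mul_volume_le_one hd hr hr2)

end Binomial

/-! ### The Poisson process as a mixture of binomial processes -/

section Mixture

/-- The probability of the value `m` under the Poisson distribution of mean `t`. -/
noncomputable def poissonWeight (t : ℝ) (m : ℕ) : ℝ :=
  Real.exp (-t) * t ^ m / m.factorial

lemma poissonWeight_nonneg {t : ℝ} (ht : 0 ≤ t) (m : ℕ) : 0 ≤ poissonWeight t m := by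
  unfold poissonWeight; positivity

lemma hasSum_poissonWeight (t : ℝ≥0) : HasSum (poissonWeight t) 1 :=
  hasSum_one_poissonMeasure t

/-- The multiset of labels with given multiplicities. -/
def multisetOfMultiplicity {q : ℕ} (c : Fin q → ℕ) : Multiset (Fin q) :=
  ∑ y, Multiset.replicate (c y) y

lemma multisetOfMultiplicity_count {q : ℕ} (ζ : Multiset (Fin q)) :
    multisetOfMultiplicity (fun y => ζ.count y) = ζ := by
  ext z
  simp [multisetOfMultiplicity, Multiset.count_sum', Multiset.count_replicate]

lemma count_preimage_singleton {E : Type*} {q : ℕ} (ℓ : E → Fin q) (ω : Multiset E) (y : Fin q) :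
    count ω (ℓ ⁻¹' {y}) = (ω.map ℓ).count y := by
  classical
  rw [Multiset.count, Multiset.countP_map, count, Multiset.countP_eq_card_filter]
  congr 1
  exact Multiset.filter_congr fun x _ => by simp [eq_comm]

/-- The limit set `A` need not be measurable: it agrees almost everywhere with the limit inferior of
the sets `As g`. -/
lemma tendsto_measureReal_of_ae_eventually_iff {Ω : Type*} [MeasurableSpace Ω] {μ : Measure Ω}
    [IsFiniteMeasure μ] {A : Set Ω} {As : ℕ → Set Ω}
    (hAs : ∀ g, MeasurableSet (As g)) (h : ∀ᵐ w ∂μ, ∀ᶠ g in atTop, w ∈ As g ↔ w ∈ A) :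
    Tendsto (fun g => μ.real (As g)) atTop (𝓝 (μ.real A)) := by
  set A' : Set Ω := {w | ∀ᶠ g in atTop, w ∈ As g} with hA'
  have hA'm : MeasurableSet A' := by
    have : A' = ⋃ N, ⋂ g ≥ N, As g := by
      ext w; simp [hA', eventually_atTop]
    rw [this]
    exact MeasurableSet.iUnion fun N => MeasurableSet.iInter fun g =>
      MeasurableSet.iInter fun _ => hAs g
  have hiff : ∀ᵐ w ∂μ, (w ∈ A' ↔ w ∈ A) := by
    filter_upwards [h] with w hw
    refine ⟨fun h1 => ?_, fun h1 => hw.mono fun g hg => hg.2 h1⟩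
    obtain ⟨g, hg1, hg2⟩ := (hw.and h1).exists
    exact hg1.1 hg2
  have hae : A' =ᵐ[μ] A := hiff.mono fun w hw => propext hw
  rw [← measureReal_congr hae]
  refine (ENNReal.tendsto_toReal (measure_ne_top _ _)).comp
    (tendsto_measure_of_ae_tendsto_indicator_of_isFiniteMeasure atTop hA'm hAs ?_)
  filter_upwards [h, hiff] with w hw hw2
  exact hw.mono fun g hg => hg.trans hw2.symm

variable {Ω E : Type*} [MeasurableSpace Ω] [MeasurableSpace E] {μ : Measure Ω}

lemma measurable_occupation {P : Ω → Multiset E}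
    (hP : ∀ A : Set E, MeasurableSet A → Measurable fun w => count (P w) A) {q : ℕ}
    {ℓ : E → Fin q} (hℓ : Measurable ℓ) :
    Measurable fun w (y : Fin q) => count (P w) (ℓ ⁻¹' {y}) :=
  measurable_pi_lambda _ fun y => hP _ (hℓ (measurableSet_singleton y))

lemma setOf_map_mem_eq_preimage {Ω E : Type*} (P : Ω → Multiset E) {q : ℕ} (ℓ : E → Fin q)
    (K : Set (Multiset (Fin q))) :
    {w | (P w).map ℓ ∈ K} =
      (fun w (y : Fin q) => count (P w) (ℓ ⁻¹' {y})) ⁻¹' {c | multisetOfMultiplicity c ∈ K} := by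
  ext w
  simp only [count_preimage_singleton, Set.mem_preimage, Set.mem_ofPred_eq,
    multisetOfMultiplicity_count]

lemma measurableSet_map_mem {P : Ω → Multiset E}
    (hP : ∀ A : Set E, MeasurableSet A → Measurable fun w => count (P w) A) {q : ℕ}
    {ℓ : E → Fin q} (hℓ : Measurable ℓ) (K : Set (Multiset (Fin q))) :
    MeasurableSet {w | (P w).map ℓ ∈ K} := by
  rw [setOf_map_mem_eq_preimage]
  exact measurable_occupation hP hℓ (Set.to_countable _).measurableSet

lemma measurable_count_binomialProcess {X : ℕ → Ω → E} (hX : ∀ j, Measurable (X j)) (m : ℕ)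
    (A : Set E) (hA : MeasurableSet A) : Measurable fun w => count (binomialProcess X m w) A := by
  classical
  simp_rw [count_binomialProcess]
  exact measurable_card_filter_mem hX _ hA

/-- Conditionally on the total number `m` of points, the occupation numbers of a Poisson process
are those of a binomial process with `m` points. -/
lemma IsPoissonProcess.measureReal_occupation_eq {ρ : Measure E} [IsProbabilityMeasure ρ] {t : ℝ≥0}
    {P : Ω → Multiset E} (hP : IsPoissonProcess P (t • ρ) μ)
    {Ω' : Type*} [MeasurableSpace Ω'] {μ' : Measure Ω'} [IsProbabilityMeasure μ']
    {X : ℕ → Ω' → E} (hX : ∀ j, Measurable (X j)) (hlaw : ∀ j, HasLaw (X j) ρ μ')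
    (hind : iIndepFun X μ') {q : ℕ} {ℓ : E → Fin q} (hℓ : Measurable ℓ) (c : Fin q → ℕ) :
    μ.real ((fun w (y : Fin q) => count (P w) (ℓ ⁻¹' {y})) ⁻¹' {c}) =
      poissonWeight t (∑ y, c y) * μ'.real ((fun w (y : Fin q) =>
        count (binomialProcess X (∑ y, c y) w) (ℓ ⁻¹' {y})) ⁻¹' {c}) := by
  have hm : ∀ y, MeasurableSet (ℓ ⁻¹' {y}) := fun y => hℓ (measurableSet_singleton y)
  have hbin : μ'.real ((fun w (y : Fin q) =>
      count (binomialProcess X (∑ y, c y) w) (ℓ ⁻¹' {y})) ⁻¹' {c}) =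
      (∑ y, c y).factorial * multinomialWeight (fun y => ρ.real (ℓ ⁻¹' {y})) c := by
    have h := KNN.measureReal_occupation_eq (μ := μ') (Y := fun j => ℓ ∘ X j)
      (fun j => hℓ.comp (hX j)) (hind.comp _ fun _ => hℓ) (p := fun y => ρ.real (ℓ ⁻¹' {y}))
      (fun j y => (hlaw j).measureReal_eq (hm y)) (Finset.range (∑ y, c y)) c
    rw [Finset.card_range, if_pos rfl] at h
    rw [← h]
    congr 1
    ext w
    classical
    simp only [count_binomialProcess, Set.mem_preimage, Set.mem_singleton_iff, funext_iff,
      Set.mem_ofPred_eq, Function.comp_apply]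
  have hpoi : μ.real ((fun w (y : Fin q) => count (P w) (ℓ ⁻¹' {y})) ⁻¹' {c}) =
      ∏ y, poissonWeight (t * ρ.real (ℓ ⁻¹' {y})) (c y) := by
    have hset : (fun w (y : Fin q) => count (P w) (ℓ ⁻¹' {y})) ⁻¹' {c} =
        ⋂ y ∈ Finset.univ, (fun w => count (P w) (ℓ ⁻¹' {y})) ⁻¹' {c y} := by
      ext w
      simp [funext_iff]
    have hdisj : Pairwise fun i j => Disjoint (ℓ ⁻¹' {i}) (ℓ ⁻¹' {j}) := fun i j hij =>
      Disjoint.preimage _ (Set.disjoint_singleton.2 hij)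
    rw [hset, measureReal_def, (hP.indep_count q _ hm hdisj).measure_inter_preimage_eq_mul
      Finset.univ fun y _ => measurableSet_singleton (c y), ENNReal.toReal_prod]
    refine Finset.prod_congr rfl fun y _ => ?_
    rw [← Measure.map_apply (hP.measurable_count _ (hm y)) (measurableSet_singleton _),
      hP.law_count _ (hm y), ← measureReal_def, poissonMeasure_real_singleton, poissonWeight]
    have : (((t • ρ) (ℓ ⁻¹' {y})).toNNReal : ℝ) = t * ρ.real (ℓ ⁻¹' {y}) := by
      rw [Measure.smul_apply, ENNReal.coe_toNNReal_eq_toReal, ENNReal.toReal_smul]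
      rfl
    rw [this]
  have hone : ∑ y, ρ.real (ℓ ⁻¹' {y}) = 1 := by
    rw [sum_measureReal_preimage_singleton _ fun y _ => hm y]
    simp
  have hf : ((∑ y, c y).factorial : ℝ) ≠ 0 := by positivity
  rw [hbin, hpoi, poissonWeight, multinomialWeight]
  simp only [poissonWeight, mul_pow, mul_div_assoc, Finset.prod_mul_distrib]
  rw [← Real.exp_sum, Finset.sum_neg_distrib, ← Finset.mul_sum, hone, mul_one,
    Finset.prod_pow_eq_pow_sum]
  field_simp

/-- An event that depends on the points through finitely many measurable labels has the same
probability for a Poisson process as for a binomial process with a Poisson number of points. -/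
lemma IsPoissonProcess.hasSum_map_mem [IsProbabilityMeasure μ] {ρ : Measure E}
    [IsProbabilityMeasure ρ] {t : ℝ≥0}
    {P : Ω → Multiset E} (hP : IsPoissonProcess P (t • ρ) μ)
    {Ω' : Type*} [MeasurableSpace Ω'] {μ' : Measure Ω'} [IsProbabilityMeasure μ']
    {X : ℕ → Ω' → E} (hX : ∀ j, Measurable (X j)) (hlaw : ∀ j, HasLaw (X j) ρ μ')
    (hind : iIndepFun X μ') {q : ℕ} {ℓ : E → Fin q} (hℓ : Measurable ℓ)
    (K : Set (Multiset (Fin q))) :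
    HasSum (fun m => poissonWeight t m * μ'.real {w | (binomialProcess X m w).map ℓ ∈ K})
      (μ.real {w | (P w).map ℓ ∈ K}) := by
  classical
  set N : Ω → Fin q → ℕ := fun w y => count (P w) (ℓ ⁻¹' {y}) with hN
  have hNm : Measurable N := measurable_occupation hP.measurable_count hℓ
  set H : Set (Fin q → ℕ) := {c | multisetOfMultiplicity c ∈ K} with hH
  set F : ℕ → Finset (Fin q → ℕ) := fun m =>
    (Finset.piAntidiag Finset.univ m).filter (· ∈ H) with hF
  have hFmem : ∀ m c, c ∈ F m ↔ ∑ y, c y = m ∧ c ∈ H := fun m c => by simp [hF]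
  have hterm : ∀ m, μ.real (N ⁻¹' (F m : Set (Fin q → ℕ))) =
      poissonWeight t m * μ'.real {w | (binomialProcess X m w).map ℓ ∈ K} := by
    intro m
    set N' : Ω' → Fin q → ℕ := fun w y => count (binomialProcess X m w) (ℓ ⁻¹' {y}) with hN'
    have hN'm : Measurable N' :=
      measurable_occupation (measurable_count_binomialProcess hX m) hℓ
    have htotal : ∀ w, ∑ y, N' w y = m := fun w => by
      simp only [hN', count_preimage_singleton]
      rw [Multiset.sum_count_eq_card fun _ _ => Finset.mem_univ _]
      simp [binomialProcess]
    have hpre : {w | (binomialProcess X m w).map ℓ ∈ K} = N' ⁻¹' (F m : Set (Fin q → ℕ)) := by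
      rw [setOf_map_mem_eq_preimage]
      ext w
      simp only [Set.mem_preimage, Finset.mem_coe, hFmem, htotal, true_and, hH]
      rfl
    rw [hpre, ← sum_measureReal_preimage_singleton _ fun c _ => hNm (measurableSet_singleton c),
      ← sum_measureReal_preimage_singleton _ fun c _ => hN'm (measurableSet_singleton c),
      Finset.mul_sum]
    refine Finset.sum_congr rfl fun c hc => ?_
    obtain ⟨rfl, -⟩ := (hFmem m c).1 hc
    exact hP.measureReal_occupation_eq hX hlaw hind hℓ c
  have hU : {w | (P w).map ℓ ∈ K} = ⋃ m, N ⁻¹' (F m : Set (Fin q → ℕ)) := by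
    rw [setOf_map_mem_eq_preimage]
    ext w
    simp only [Set.mem_iUnion, Set.mem_preimage, Finset.mem_coe, hFmem, exists_eq_left']
    simp [hH, hN]
  have hd : Pairwise (Function.onFun Disjoint fun m => N ⁻¹' (F m : Set (Fin q → ℕ))) := by
    intro m m' hmm
    refine Disjoint.preimage _ (Set.disjoint_left.2 fun c hc hc' => hmm ?_)
    rw [← ((hFmem m c).1 hc).1, ← ((hFmem m' c).1 hc').1]
  have hmeas : ∀ m, MeasurableSet (N ⁻¹' (F m : Set (Fin q → ℕ))) := fun m =>
    hNm (Set.to_countable _).measurableSet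
  have hs := measure_iUnion (μ := μ) hd hmeas
  rw [← hU] at hs
  have hne : ∑' m, μ (N ⁻¹' (F m : Set (Fin q → ℕ))) ≠ ∞ := hs ▸ measure_ne_top _ _
  have h := ENNReal.hasSum_toReal hne
  rw [← ENNReal.tsum_toReal_eq fun m => measure_ne_top _ _, ← hs] at h
  exact (funext hterm) ▸ h

/-- The unit cube has finite measurable partitions of arbitrarily small mesh: `ℓ` labels the cells
and `c` chooses a representative of each. -/
lemma exists_finite_labelling {d : ℕ} {ε : ℝ} (hε : 0 < ε) :
    ∃ (q : ℕ) (ℓ : EuclideanSpace ℝ (Fin d) → Fin q) (c : Fin q → EuclideanSpace ℝ (Fin d)),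
      Measurable ℓ ∧ ∀ x ∈ unitCube d, ‖c (ℓ x) - x‖ ≤ ε := by
  let e := TopologicalSpace.denseSeq (EuclideanSpace ℝ (Fin d))
  have hcov : unitCube d ⊆ ⋃ n, Metric.ball (e n) ε := fun x _ => by
    obtain ⟨n, hn⟩ := (TopologicalSpace.denseRange_denseSeq _).exists_dist_lt x hε
    exact Set.mem_iUnion.2 ⟨n, hn⟩
  obtain ⟨t, ht⟩ := isCompact_unitCube.elim_finite_subcover _ (fun n => Metric.isOpen_ball) hcov
  set N := t.sup id with hN
  refine ⟨N + 1, fun x => ⟨SimpleFunc.nearestPtInd e N x,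
    Nat.lt_succ_of_le (SimpleFunc.nearestPtInd_le e N x)⟩, fun y => e y, ?_, fun x hx => ?_⟩
  · exact measurable_to_countable' fun y => by
      have : (fun x => (⟨SimpleFunc.nearestPtInd e N x,
          Nat.lt_succ_of_le (SimpleFunc.nearestPtInd_le e N x)⟩ : Fin (N + 1))) ⁻¹' {y} =
          SimpleFunc.nearestPtInd e N ⁻¹' {(y : ℕ)} := by
        ext x; simp [Fin.ext_iff]
      rw [this]
      exact SimpleFunc.measurableSet_preimage _ _
  · obtain ⟨n, hn, hxn⟩ := Set.mem_iUnion₂.1 (ht hx)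
    have h := SimpleFunc.edist_nearestPt_le e x (Finset.le_sup (f := id) hn)
    rw [edist_dist, edist_dist, ENNReal.ofReal_le_ofReal_iff dist_nonneg] at h
    rw [← dist_eq_norm]
    exact h.trans (by rw [dist_comm]; exact (Metric.mem_ball.1 hxn).le)

/-- A version of the event `1 ≤ lowDegreeCount k r ω` that depends on the points only through
labels with representatives `c y`: some label has at most `k` labels, with multiplicity, within
distance `s` of it. -/
def labelledEvent {d q : ℕ} (k : ℕ) (s : ℝ) (c : Fin q → EuclideanSpace ℝ (Fin d)) :
    Set (Multiset (Fin q)) :=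
  open Classical in {ζ | ∃ y ∈ ζ, ζ.countP (fun y' => torusDist (c y) (c y') ≤ s) ≤ k}

/-- For a finite configuration in the cube, the labelled event is eventually the exact one as the
labels get finer. The slack `2 * δ g` in the radius keeps the pairs at distance exactly `r`. -/
lemma eventually_map_mem_labelledEvent_iff {d k : ℕ} {r : ℝ} {q : ℕ → ℕ}
    {ℓ : ∀ g, EuclideanSpace ℝ (Fin d) → Fin (q g)}
    {c : ∀ g, Fin (q g) → EuclideanSpace ℝ (Fin d)} {δ : ℕ → ℝ} (hδ : Tendsto δ atTop (𝓝 0))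
    (hc : ∀ g, ∀ x ∈ unitCube d, ‖c g (ℓ g x) - x‖ ≤ δ g)
    {ω : Multiset (EuclideanSpace ℝ (Fin d))} (hω : ∀ x ∈ ω, x ∈ unitCube d) :
    ∀ᶠ g in atTop, ω.map (ℓ g) ∈ labelledEvent k (r + 2 * δ g) (c g) ↔
      1 ≤ lowDegreeCount k r ω := by
  classical
  have hpair : ∀ x ∈ ω, ∀ y ∈ ω, ∀ᶠ g in atTop,
      (torusDist (c g (ℓ g x)) (c g (ℓ g y)) ≤ r + 2 * δ g ↔ torusDist x y ≤ r) := by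
    intro x hx y hy
    have hle : ∀ g, |torusDist (c g (ℓ g x)) (c g (ℓ g y)) - torusDist x y| ≤ 2 * δ g :=
      fun g => by
        have := abs_torusDist_sub_le (c g (ℓ g x)) (c g (ℓ g y)) x y
        linarith [hc g x (hω x hx), hc g y (hω y hy)]
    by_cases h : torusDist x y ≤ r
    · refine Eventually.of_forall fun g => iff_of_true ?_ h
      linarith [(abs_le.1 (hle g)).2]
    · have hpos : 0 < (torusDist x y - r) / 4 := by linarith [not_le.1 h]
      filter_upwards [hδ.eventually_lt_const hpos] with g hg
      refine iff_of_false (fun h' => ?_) h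
      linarith [(abs_le.1 (hle g)).1]
  have hall : ∀ᶠ g in atTop, ∀ x ∈ ω.toFinset, ∀ y ∈ ω.toFinset,
      (torusDist (c g (ℓ g x)) (c g (ℓ g y)) ≤ r + 2 * δ g ↔ torusDist x y ≤ r) := by
    rw [Filter.eventually_all_finset]
    intro x hx
    rw [Filter.eventually_all_finset]
    exact fun y hy => hpair x (Multiset.mem_toFinset.1 hx) y (Multiset.mem_toFinset.1 hy)
  filter_upwards [hall] with g hg
  rw [one_le_lowDegreeCount_iff, labelledEvent]
  simp only [Set.mem_ofPred_eq, Multiset.mem_map, exists_exists_and_eq_and]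
  refine exists_congr fun x => and_congr_right fun hx => ?_
  rw [Multiset.countP_map, ← Multiset.countP_eq_card_filter, count]
  refine iff_of_eq (congrArg (· ≤ k) (Multiset.countP_congr rfl fun y hy => ?_))
  rw [hg x (Multiset.mem_toFinset.2 hx) y (Multiset.mem_toFinset.2 hy)]
  exact propext ⟨fun h => ⟨hω y hy, h⟩, fun h => h.2⟩

lemma IsPoissonProcess.ae_forall_mem {ρ : Measure E} [IsProbabilityMeasure ρ] {t : ℝ≥0}
    {P : Ω → Multiset E} (hP : IsPoissonProcess P (t • ρ) μ) {A : Set E} (hA : MeasurableSet A)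
    (h : ∀ᵐ x ∂ρ, x ∈ A) : ∀ᵐ w ∂μ, ∀ x ∈ P w, x ∈ A := by
  have h0 : ρ Aᶜ = 0 := h
  have hlaw := hP.law_count Aᶜ hA.compl
  rw [Measure.smul_apply, h0, smul_zero, ENNReal.toNNReal_zero] at hlaw
  have h1 : ∀ᵐ n ∂(poissonMeasure 0), n = 0 := by
    rw [ae_iff, show {n : ℕ | ¬ n = 0} = {0}ᶜ from rfl,
      prob_compl_eq_zero_iff (measurableSet_singleton 0), poissonMeasure_singleton]
    simp
  rw [← hlaw] at h1
  filter_upwards [ae_of_ae_map (hP.measurable_count _ hA.compl).aemeasurable h1] with w hw x hx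
  by_contra hxA
  simp only [count, Multiset.countP_eq_zero] at hw
  exact hw x hx hxA

/-- The probability that a Poisson process has a point of low degree is the corresponding mixture
of the probabilities for binomial processes. -/
theorem IsPoissonProcess.hasSum_lowDegree [IsProbabilityMeasure μ] {d k : ℕ} {r : ℝ} {t : ℝ≥0}
    {P : Ω → Multiset (EuclideanSpace ℝ (Fin d))}
    (hP : IsPoissonProcess P (t • cubeMeasure d) μ)
    {Ω' : Type*} [MeasurableSpace Ω'] {μ' : Measure Ω'} [IsProbabilityMeasure μ']
    {X : ℕ → Ω' → EuclideanSpace ℝ (Fin d)} (hX : ∀ j, Measurable (X j))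
    (hlaw : ∀ j, HasLaw (X j) (cubeMeasure d) μ') (hind : iIndepFun X μ') :
    HasSum (fun m => poissonWeight t m *
        μ'.real {w | 1 ≤ lowDegreeCount k r (binomialProcess X m w)})
      (μ.real {w | 1 ≤ lowDegreeCount k r (P w)}) := by
  have hδpos : ∀ g : ℕ, (0 : ℝ) < 1 / ((g : ℝ) + 1) := fun g => by positivity
  choose q ℓ c hℓ hc using fun g : ℕ => exists_finite_labelling (d := d) (hδpos g)
  have hδ : Tendsto (fun g : ℕ => 1 / ((g : ℝ) + 1)) atTop (𝓝 0) :=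
    tendsto_one_div_add_atTop_nhds_zero_nat
  set K := fun g : ℕ => labelledEvent k (r + 2 * (1 / ((g : ℝ) + 1))) (c g)
  have hsum : ∀ g, HasSum (fun m => poissonWeight t m *
      μ'.real {w | (binomialProcess X m w).map (ℓ g) ∈ K g})
      (μ.real {w | (P w).map (ℓ g) ∈ K g}) := fun g =>
    hP.hasSum_map_mem hX hlaw hind (hℓ g) (K g)
  have hlimP : Tendsto (fun g => μ.real {w | (P w).map (ℓ g) ∈ K g}) atTop
      (𝓝 (μ.real {w | 1 ≤ lowDegreeCount k r (P w)})) := by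
    refine tendsto_measureReal_of_ae_eventually_iff
      (fun g => measurableSet_map_mem hP.measurable_count (hℓ g) _) ?_
    filter_upwards [hP.ae_forall_mem measurableSet_unitCube ae_mem_unitCube] with w hw
    exact eventually_map_mem_labelledEvent_iff hδ hc hw
  have hlimX : ∀ m, Tendsto (fun g => μ'.real {w | (binomialProcess X m w).map (ℓ g) ∈ K g}) atTop
      (𝓝 (μ'.real {w | 1 ≤ lowDegreeCount k r (binomialProcess X m w)})) := fun m => by
    refine tendsto_measureReal_of_ae_eventually_iff
      (fun g => measurableSet_map_mem (measurable_count_binomialProcess hX m) (hℓ g) _) ?_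
    filter_upwards [ae_all_iff.2 fun j => ae_mem_unitCube_of_hasLaw (hlaw j)] with w hw
    refine eventually_map_mem_labelledEvent_iff hδ hc fun x hx => ?_
    obtain ⟨j, -, rfl⟩ := Multiset.mem_map.1 hx
    exact hw j
  have hbound : ∀ (m : ℕ) (A : Set Ω'),
      ‖poissonWeight t m * μ'.real A‖ ≤ poissonWeight t m := fun m A => by
    rw [Real.norm_of_nonneg (mul_nonneg (poissonWeight_nonneg t.coe_nonneg m) measureReal_nonneg)]
    exact mul_le_of_le_one_right (poissonWeight_nonneg t.coe_nonneg m) measureReal_le_one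
  have htend := tendsto_tsum_of_dominated_convergence (𝓕 := atTop)
    (hasSum_poissonWeight t).summable
    (fun m => (hlimX m).const_mul (poissonWeight t m))
    (Eventually.of_forall fun g m => hbound m _)
  have heq := tendsto_nhds_unique (htend.congr fun g => (hsum g).tsum_eq) hlimP
  rw [← heq]
  exact (Summable.of_norm_bounded (hasSum_poissonWeight t).summable
    fun m => hbound m _).hasSum

end Mixture

/-! ### Poissonization of the moment bounds -/

section Poissonization

/-- The probability that a Poisson variable of mean `t` is less than `I`. -/
noncomputable def poissonCdf (t : ℝ) (I : ℕ) : ℝ :=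
  ∑ i ∈ Finset.range I, poissonWeight t i

lemma poissonCdf_nonneg {t : ℝ} (ht : 0 ≤ t) (I : ℕ) : 0 ≤ poissonCdf t I :=
  Finset.sum_nonneg fun _ _ => poissonWeight_nonneg ht _

lemma poissonCdf_zero_one : poissonCdf 0 1 = 1 := by
  simp [poissonCdf, poissonWeight]

/-- Poisson thinning: the numbers of points of a Poisson process of intensity `t` in disjoint cells
of probabilities `v` and `u` are independent Poisson variables of means `t v` and `t u`. -/
lemma hasSum_poissonWeight_mul_trinomialTerm (t v u : ℝ) (i j : ℕ) :
    HasSum (fun M => poissonWeight t M * trinomialTerm M v u i j)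
      (poissonWeight (t * v) i * poissonWeight (t * u) j) := by
  have h0 : ∀ M ∈ Finset.range (i + j), poissonWeight t M * trinomialTerm M v u i j = 0 := by
    intro M hM
    rw [Finset.mem_range] at hM
    rcases lt_or_ge M i with h | h
    · simp [trinomialTerm, Nat.choose_eq_zero_of_lt h]
    · simp [trinomialTerm, Nat.choose_eq_zero_of_lt (show M - i < j by omega)]
  rw [← hasSum_nat_add_iff' (i + j), Finset.sum_eq_zero h0, sub_zero]
  have hexp := (NormedSpace.expSeries_div_hasSum_exp (t * (1 - v - u))).mul_left
    (Real.exp (-t) * ((t * v) ^ i / i.factorial) * ((t * u) ^ j / j.factorial))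
  convert! hexp using 1
  · funext l
    have e1 : l + (i + j) - i = l + j := by omega
    rw [poissonWeight, trinomialTerm, Nat.cast_choose ℝ (by omega : i ≤ l + (i + j)), e1,
      Nat.cast_choose ℝ (by omega : j ≤ l + j), Nat.add_sub_cancel]
    have f1 : ((l + (i + j)).factorial : ℝ) ≠ 0 := by positivity
    have f2 : ((l + j).factorial : ℝ) ≠ 0 := by positivity
    have f3 : (l.factorial : ℝ) ≠ 0 := by positivity
    have f4 : (i.factorial : ℝ) ≠ 0 := by positivity
    have f5 : (j.factorial : ℝ) ≠ 0 := by positivity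
    simp only [mul_pow]
    field_simp
    ring
  · rw [← Real.exp_eq_exp_ℝ, poissonWeight, poissonWeight,
      show t * (1 - v - u) = t + -(t * v) + -(t * u) by ring, Real.exp_add, Real.exp_add]
    have : Real.exp (-t) * Real.exp t = 1 := by rw [← Real.exp_add]; simp
    linear_combination (-(Real.exp (-(t * v)) * Real.exp (-(t * u)) *
      ((t * v) ^ i / i.factorial) * ((t * u) ^ j / j.factorial))) * this

lemma hasSum_poissonWeight_mul_trinomialCdf (t v u : ℝ) (I J : ℕ) :
    HasSum (fun M => poissonWeight t M * trinomialCdf M v u I J)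
      (poissonCdf (t * v) I * poissonCdf (t * u) J) := by
  have h := hasSum_sum (s := Finset.range I) fun i _ => hasSum_sum (s := Finset.range J)
    fun j _ => hasSum_poissonWeight_mul_trinomialTerm t v u i j
  convert! h using 1
  · funext M
    simp only [trinomialCdf, Finset.mul_sum]
  · rw [poissonCdf, poissonCdf, Finset.sum_mul_sum]

/-- The size-biasing identity `E[N f(N - 1)] = t E[f(N)]` for a Poisson variable `N` of mean
`t`. -/
lemma hasSum_poissonWeight_mul_cast {t x : ℝ} {f : ℕ → ℝ}
    (hf : HasSum (fun m => poissonWeight t m * f m) x) :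
    HasSum (fun m => poissonWeight t m * (m * f (m - 1))) (t * x) := by
  rw [← hasSum_nat_add_iff' 1]
  simp only [Finset.range_one, Finset.sum_singleton, Nat.cast_zero, zero_mul, mul_zero, sub_zero]
  convert! hf.mul_left t using 1
  funext m
  rw [Nat.add_sub_cancel, poissonWeight, poissonWeight, Nat.factorial_succ]
  have : (m.factorial : ℝ) ≠ 0 := by positivity
  push_cast
  field_simp
  ring

/-- The counterpart of `pairBound` for a Poisson process of intensity `t`. -/
noncomputable def poissonPairBound (d k : ℕ) (ε v t : ℝ) : ℝ :=
  poissonCdf (t * v) k * poissonCdf (t * v) k +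
    2 ^ d * v * (poissonCdf (t * v) k * poissonCdf (t * ((ε / 4) ^ d * v)) k) +
    ε ^ d * v * poissonCdf (t * v) (k - 1)

lemma hasSum_poissonWeight_mul_pairBound (d k : ℕ) (ε v t : ℝ) :
    HasSum (fun M => poissonWeight t M * pairBound d k ε v M) (poissonPairBound d k ε v t) := by
  have h1 := hasSum_poissonWeight_mul_trinomialCdf t v v k k
  have h2 := (hasSum_poissonWeight_mul_trinomialCdf t v ((ε / 4) ^ d * v) k k).mul_left
    (2 ^ d * v)
  have h3 := (hasSum_poissonWeight_mul_trinomialCdf t v 0 (k - 1) 1).mul_left (ε ^ d * v)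
  rw [mul_zero, poissonCdf_zero_one, mul_one] at h3
  convert! (h1.add h2).add h3 using 1
  funext M
  rw [pairBound]
  ring

/-- Trinomial probabilities for `M` points are at most a constant times the Poisson probabilities
for intensity `M + 2`, the total number of points when a pair is set apart. -/
lemma trinomialTerm_le {M : ℕ} {v u : ℝ} (hv : 0 ≤ v) (hu : 0 ≤ u) (hvu : v + u ≤ 1) (i j : ℕ) :
    trinomialTerm M v u i j ≤ Real.exp (2 + i + j) *
      (poissonWeight ((M + 2) * v) i * poissonWeight ((M + 2) * u) j) := by
  have c1 : (M.choose i : ℝ) ≤ ((M : ℝ) + 2) ^ i / i.factorial :=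
    (Nat.choose_le_pow_div i M).trans (by gcongr; linarith)
  have c2 : ((M - i).choose j : ℝ) ≤ ((M : ℝ) + 2) ^ j / j.factorial := by
    refine (Nat.choose_le_pow_div j (M - i)).trans ?_
    have : ((M - i : ℕ) : ℝ) ≤ M := by exact_mod_cast Nat.sub_le M i
    gcongr
    linarith
  have c3 : (1 - v - u) ^ (M - i - j) ≤
      Real.exp (2 + i + j) * (Real.exp (-((M + 2) * v)) * Real.exp (-((M + 2) * u))) := by
    have h1 : 1 - v - u ≤ Real.exp (-(v + u)) := by
      linarith [Real.add_one_le_exp (-(v + u))]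
    have h2 : (M : ℝ) - i - j ≤ ((M - i - j : ℕ) : ℝ) := by
      have : M ≤ (M - i - j) + i + j := by omega
      have : (M : ℝ) ≤ ((M - i - j : ℕ) : ℝ) + i + j := by exact_mod_cast this
      linarith
    refine (pow_le_pow_left₀ (by linarith) h1 _).trans ?_
    rw [← Real.exp_nat_mul, ← Real.exp_add, ← Real.exp_add, Real.exp_le_exp]
    have h3 : (0 : ℝ) ≤ 2 + i + j := by positivity
    nlinarith [mul_le_mul_of_nonneg_right h2 (add_nonneg hv hu),
      mul_le_mul_of_nonneg_left hvu h3]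
  have h0 : 0 ≤ (1 - v - u) ^ (M - i - j) := pow_nonneg (by linarith) _
  rw [trinomialTerm]
  calc (M.choose i : ℝ) * (M - i).choose j * v ^ i * u ^ j * (1 - v - u) ^ (M - i - j)
      ≤ (((M : ℝ) + 2) ^ i / i.factorial) * (((M : ℝ) + 2) ^ j / j.factorial) * v ^ i * u ^ j *
        (Real.exp (2 + i + j) * (Real.exp (-((M + 2) * v)) * Real.exp (-((M + 2) * u)))) := by
        gcongr
    _ = _ := by
        rw [poissonWeight, poissonWeight, mul_pow, mul_pow]
        ring

lemma trinomialCdf_le {M : ℕ} {v u : ℝ} (hv : 0 ≤ v) (hu : 0 ≤ u) (hvu : v + u ≤ 1) {I J K : ℕ}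
    (hK : I + J ≤ K) :
    trinomialCdf M v u I J ≤ Real.exp (2 + K) *
      (poissonCdf ((M + 2) * v) I * poissonCdf ((M + 2) * u) J) := by
  rw [trinomialCdf, poissonCdf, poissonCdf, Finset.sum_mul_sum, Finset.mul_sum]
  refine Finset.sum_le_sum fun i hi => ?_
  rw [Finset.mul_sum]
  refine Finset.sum_le_sum fun j hj => (trinomialTerm_le hv hu hvu i j).trans ?_
  have h1 := Finset.mem_range.1 hi
  have h2 := Finset.mem_range.1 hj
  have h3 : (i : ℝ) + j ≤ K := by exact_mod_cast (by omega : i + j ≤ K)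
  have h4 := poissonWeight_nonneg (mul_nonneg (by positivity : (0 : ℝ) ≤ (M : ℝ) + 2) hv) i
  have h5 := poissonWeight_nonneg (mul_nonneg (by positivity : (0 : ℝ) ≤ (M : ℝ) + 2) hu) j
  exact mul_le_mul_of_nonneg_right (Real.exp_le_exp.2 (by linarith)) (mul_nonneg h4 h5)

lemma pairBound_le (d : ℕ) {k : ℕ} (hk : 1 ≤ k) (M : ℕ) {ε v : ℝ} (hε : 0 ≤ ε) (hε1 : ε ≤ 1)
    (hv : 0 ≤ v) (hv2 : 2 * v ≤ 1) :
    pairBound d k ε v M ≤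
      Real.exp (2 + (2 * k : ℕ)) * poissonPairBound d k ε v (M + 2) := by
  have hc : (ε / 4) ^ d ≤ 1 := pow_le_one₀ (by positivity) (by linarith)
  have h1 := trinomialCdf_le (M := M) hv hv (by linarith) (show k + k ≤ 2 * k by omega)
  have h2 := trinomialCdf_le (M := M) hv (u := (ε / 4) ^ d * v) (by positivity)
    (by nlinarith) (show k + k ≤ 2 * k by omega)
  have h3 := trinomialCdf_le (M := M) hv le_rfl (by linarith) (show (k - 1) + 1 ≤ 2 * k by omega)
  rw [mul_zero, poissonCdf_zero_one, mul_one] at h3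
  have h2' := mul_le_mul_of_nonneg_left h2 (by positivity : 0 ≤ 2 ^ d * v)
  have h3' := mul_le_mul_of_nonneg_left h3 (by positivity : 0 ≤ ε ^ d * v)
  rw [pairBound, poissonPairBound]
  linarith

variable {d : ℕ}

/-- First and second moment bounds for the probability that some point of a Poisson process has a
low degree. -/
theorem poisson_probability_bounds {Ω : Type*} [MeasurableSpace Ω] {μ : Measure Ω}
    [IsProbabilityMeasure μ] {t : ℝ≥0} {P : Ω → Multiset (EuclideanSpace ℝ (Fin d))}
    (hP : IsPoissonProcess P (t • cubeMeasure d) μ) (hd : 1 ≤ d) (k : ℕ) {r : ℝ}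
    (hr : 0 < r) (hr2 : r ≤ 1 / 6) {ε : ℝ} (hε : 0 < ε) (hε1 : ε ≤ 1) :
    μ.real {w | 1 ≤ lowDegreeCount k r (P w)} ≤ t * poissonCdf (t * (r ^ d * theta d)) k ∧
      t * poissonCdf (t * (r ^ d * theta d)) k -
          t ^ 2 * poissonPairBound d k ε (r ^ d * theta d) t ≤
        μ.real {w | 1 ≤ lowDegreeCount k r (P w)} := by
  obtain ⟨Ω', _, μ', X, hX, hlaw, hind, _⟩ := exists_iid ℕ (cubeMeasure d)
  have hmix := hP.hasSum_lowDegree (k := k) (r := r) hX hlaw hind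
  have hbin := binomial_probability_bounds hX hlaw hind hd k hr hr2 hε hε1
  have h1 := hasSum_poissonWeight_mul_cast
    (hasSum_poissonWeight_mul_trinomialCdf t (r ^ d * theta d) 0 k 1)
  rw [mul_zero, poissonCdf_zero_one, mul_one] at h1
  have h2 := hasSum_poissonWeight_mul_cast (hasSum_poissonWeight_mul_cast
    (hasSum_poissonWeight_mul_pairBound d k ε (r ^ d * theta d) t))
  refine ⟨hasSum_le (fun m => ?_) hmix h1, ?_⟩
  · exact mul_le_mul_of_nonneg_left (hbin m).1 (poissonWeight_nonneg t.coe_nonneg m)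
  · rw [pow_two, mul_assoc]
    refine hasSum_le (fun m => ?_) (h1.sub h2) hmix
    rw [← mul_sub]
    refine mul_le_mul_of_nonneg_left ?_ (poissonWeight_nonneg t.coe_nonneg m)
    refine le_trans (le_of_eq ?_) (hbin m).2
    cases m with
    | zero => simp
    | succ m =>
      simp only [Nat.add_sub_cancel, Nat.cast_add, Nat.cast_one, add_sub_cancel_right]
      rw [show m + 1 - 2 = m - 1 by omega]
      ring

end Poissonization

/-! ### Asymptotics -/

section Asymptotics

lemma tendsto_poissonWeight_div (κ i : ℕ) (hi : i ≤ κ) (s : ℝ) :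
    Tendsto (fun x : ℝ => poissonWeight (x + s) i / (x ^ κ * Real.exp (-x))) atTop
      (𝓝 (if i = κ then Real.exp (-s) / κ.factorial else 0)) := by
  have h1 : Tendsto (fun x : ℝ => 1 + s / x) atTop (𝓝 1) := by
    simpa using (tendsto_const_nhds (x := (1 : ℝ))).add (tendsto_id.const_div_atTop s)
  have h2 : Tendsto (fun x : ℝ => x⁻¹ ^ (κ - i)) atTop (𝓝 (if i = κ then 1 else 0)) := by
    have h := (tendsto_inv_atTop_zero (𝕜 := ℝ)).pow (κ - i)
    rcases hi.eq_or_lt with rfl | hlt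
    · simp
    · rw [if_neg hlt.ne]
      rwa [zero_pow (by omega)] at h
  have h3 := ((h1.pow i).mul h2).const_mul (Real.exp (-s) / i.factorial)
  have hlim : Real.exp (-s) / i.factorial * (1 ^ i * if i = κ then 1 else 0) =
      if i = κ then Real.exp (-s) / κ.factorial else 0 := by
    split_ifs with h
    · simp [h]
    · simp
  rw [hlim] at h3
  refine h3.congr' ?_
  filter_upwards [eventually_gt_atTop 0] with x hx
  have hp : x ^ κ = x ^ i * x ^ (κ - i) := by rw [← pow_add]; congr 1; omega
  rw [poissonWeight, neg_add, Real.exp_add, hp, show x + s = x * (1 + s / x) by field_simp,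
    mul_pow, inv_pow]
  have := Real.exp_pos (-x)
  field_simp

lemma tendsto_poissonCdf_div {k : ℕ} (hk : 1 ≤ k) (s : ℝ) :
    Tendsto (fun x : ℝ => poissonCdf (x + s) k / (x ^ (k - 1) * Real.exp (-x))) atTop
      (𝓝 (alpha k s)) := by
  have h := tendsto_finsetSum (Finset.range k) fun i hi =>
    tendsto_poissonWeight_div (k - 1) i (by have := Finset.mem_range.1 hi; omega) s
  rw [Finset.sum_ite_eq' , if_pos (Finset.mem_range.2 (by omega))] at h
  simpa only [poissonCdf, Finset.sum_div, alpha] using h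

/-- For a pair of points in each other's ball, the gain of a factor of order `x⁻¹` from the loss of
one admissible point offsets the expected number, of order `x`, of points in a ball. -/
lemma exists_tendsto_mul_poissonCdf_pred_div (k : ℕ) (s : ℝ) :
    ∃ C, Tendsto (fun x : ℝ => (x + s) * poissonCdf (x + s) (k - 1) /
      (x ^ (k - 1) * Real.exp (-x))) atTop (𝓝 C) := by
  rcases Nat.lt_or_ge k 2 with hk | hk
  · refine ⟨0, ?_⟩
    simp [show k - 1 = 0 by omega, poissonCdf]
  · refine ⟨1 * alpha (k - 1) s, ?_⟩
    have h1 : Tendsto (fun x : ℝ => 1 + s / x) atTop (𝓝 1) := by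
      simpa using (tendsto_const_nhds (x := (1 : ℝ))).add (tendsto_id.const_div_atTop s)
    refine (h1.mul (tendsto_poissonCdf_div (k := k - 1) (by omega) s)).congr' ?_
    filter_upwards [eventually_gt_atTop 0] with x hx
    have hp : x ^ (k - 1) = x * x ^ (k - 1 - 1) := by
      rw [← pow_succ']; congr 1; omega
    rw [hp]
    field_simp

lemma tendsto_mul_poissonCdf_atTop {c : ℝ} (hc : 0 < c) (k : ℕ) :
    Tendsto (fun x : ℝ => x * poissonCdf (x * c) k) atTop (𝓝 0) := by
  have h : ∀ i ∈ Finset.range k,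
      Tendsto (fun x : ℝ => x * poissonWeight (x * c) i) atTop (𝓝 0) := fun i _ => by
    have h1 := ((Real.tendsto_pow_mul_exp_neg_atTop_nhds_zero (i + 1)).comp
      (tendsto_id.atTop_mul_const hc)).mul_const (1 / (c * i.factorial))
    rw [zero_mul] at h1
    refine h1.congr fun x => ?_
    simp only [Function.comp_apply, id, poissonWeight]
    field_simp
    ring
  have h2 := tendsto_finsetSum (Finset.range k) h
  simpa only [Finset.sum_const_zero, poissonCdf, Finset.mul_sum] using h2

variable {a : ℕ → ℝ} {k : ℕ}

lemma tendsto_atTop_of_tendsto_sub_log (hk : 1 ≤ k)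
    (ha : Tendsto (fun n : ℕ => a n - Real.log n - ((k : ℝ) - 1) * Real.log (Real.log n))
      atTop atTop) : Tendsto a atTop atTop := by
  have hL : Tendsto (fun n : ℕ => Real.log n) atTop atTop :=
    Real.tendsto_log_atTop.comp tendsto_natCast_atTop_atTop
  refine tendsto_atTop_mono' _ ?_ ha
  filter_upwards [hL.eventually_ge_atTop 1] with n hn
  have h1 : (1 : ℝ) ≤ k := by exact_mod_cast hk
  nlinarith [mul_nonneg (sub_nonneg.2 h1) (Real.log_nonneg hn)]

lemma scaling_pos {n : ℕ} (hn : 1 ≤ n) (ha : 0 < a n) : 0 < scaling k a n := by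
  unfold scaling
  have : (0 : ℝ) < n := by exact_mod_cast hn
  positivity

/-- The hypothesis on `a` is used at full strength only here: the expected number of points of low
degree tends to `0`. -/
lemma tendsto_scaling_zero (hk : 1 ≤ k)
    (ha : Tendsto (fun n : ℕ => a n - Real.log n - ((k : ℝ) - 1) * Real.log (Real.log n))
      atTop atTop) : Tendsto (scaling k a) atTop (𝓝 0) := by
  have hL : Tendsto (fun n : ℕ => Real.log n) atTop atTop :=
    Real.tendsto_log_atTop.comp tendsto_natCast_atTop_atTop
  have ha' := tendsto_atTop_of_tendsto_sub_log hk ha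
  have hexp : Tendsto (fun n : ℕ => Real.exp (-((a n - Real.log n - ((k : ℝ) - 1) *
      Real.log (Real.log n)) / 2) + ((k : ℝ) - 1) ^ 2)) atTop (𝓝 0) :=
    Real.tendsto_exp_atBot.comp (tendsto_atBot_add_const_right _ _
      (tendsto_neg_atTop_atBot.comp (ha.atTop_div_const two_pos)))
  refine squeeze_zero' ?_ ?_ hexp
  · filter_upwards [ha'.eventually_gt_atTop 0, eventually_ge_atTop 1] with n h1 h2
    exact (scaling_pos h2 h1).le
  · filter_upwards [ha'.eventually_gt_atTop 0, eventually_ge_atTop 1,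
      hL.eventually_ge_atTop (2 * ((k : ℝ) - 1)), hL.eventually_ge_atTop 1,
      ha.eventually_ge_atTop 0] with n h1 h2 h3 h4 h5
    have hn : (0 : ℝ) < n := by exact_mod_cast h2
    have hκ : (0 : ℝ) ≤ (k : ℝ) - 1 := sub_nonneg.2 (by exact_mod_cast hk)
    set L := Real.log n with hLdef
    set κ : ℝ := (k : ℝ) - 1 with hκdef
    set D := a n - L - κ * Real.log L with hD
    have hL0 : 0 < L := by linarith
    have e1 : scaling k a n = Real.exp (L + κ * Real.log (a n) - a n) := by
      rw [scaling, sub_eq_add_neg, Real.exp_add, Real.exp_add, hLdef, Real.exp_log hn,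
        mul_comm κ, Real.exp_mul, Real.exp_log h1, hκdef, ← Nat.cast_pred (by omega : 0 < k),
        Real.rpow_natCast]
    rw [e1, Real.exp_le_exp]
    -- the tangent of the logarithm at `L` bounds `log (a n)`
    have e2 : Real.log (a n) ≤ Real.log L + (a n / L - 1) := by
      have := Real.log_le_sub_one_of_pos (div_pos h1 hL0)
      rw [Real.log_div h1.ne' hL0.ne'] at this
      linarith
    have e3 : a n / L - 1 = (κ * Real.log L + D) / L := by
      rw [hD]; field_simp; ring
    have e4 : Real.log L / L ≤ 1 := by
      rw [div_le_one hL0]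
      linarith [Real.log_le_sub_one_of_pos hL0]
    have e5 : κ * (D / L) ≤ D / 2 := by
      rw [mul_div_assoc', div_le_div_iff₀ hL0 two_pos]
      nlinarith
    have e6 : κ * Real.log (a n) ≤ κ * Real.log L + κ ^ 2 * (Real.log L / L) + κ * (D / L) := by
      refine (mul_le_mul_of_nonneg_left e2 hκ).trans (le_of_eq ?_)
      rw [e3]; ring
    have e7 := mul_le_mul_of_nonneg_left e4 (sq_nonneg κ)
    have e8 : a n = D + L + κ * Real.log L := by rw [hD]; ring
    linarith

lemma radius_pow_mul_theta {d : ℕ} (hd : 1 ≤ d) {s : ℝ} {n : ℕ} (h : 0 ≤ a n + s) :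
    radius d a s n ^ d * theta d = (a n + s) / n := by
  have hθ := theta_pos (d := d)
  rw [radius, one_div, Real.rpow_inv_natCast_pow (by positivity) (by omega)]
  field_simp

lemma tendsto_add_const_div_natCast (hao : a =o[atTop] fun n : ℕ => (n : ℝ)) (s : ℝ) :
    Tendsto (fun n : ℕ => (a n + s) / n) atTop (𝓝 0) := by
  have h := hao.tendsto_div_nhds_zero.add
    (tendsto_const_div_atTop_nhds_zero_nat s)
  simpa [add_div] using h

lemma eventually_radius {d : ℕ} (hd : 1 ≤ d) (hk : 1 ≤ k)
    (ha : Tendsto (fun n : ℕ => a n - Real.log n - ((k : ℝ) - 1) * Real.log (Real.log n))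
      atTop atTop) (hao : a =o[atTop] fun n : ℕ => (n : ℝ)) (s : ℝ) :
    ∀ᶠ n in atTop, 0 < radius d a s n ∧ radius d a s n ≤ 1 / 6 ∧
      radius d a s n ^ d * theta d = (a n + s) / n := by
  have ha' := tendsto_atTop_of_tendsto_sub_log hk ha
  have hθ := theta_pos (d := d)
  have h1 : Tendsto (radius d a s) atTop (𝓝 0) := by
    have h := ((tendsto_add_const_div_natCast hao s).div_const (theta d)).rpow_const
      (p := 1 / (d : ℝ)) (Or.inr (by positivity))
    rw [zero_div, Real.zero_rpow (by positivity)] at h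
    simp only [div_div] at h
    exact h
  filter_upwards [h1.eventually_le_const (show (0 : ℝ) < 1 / 6 by norm_num),
    ha'.eventually_gt_atTop (-s), eventually_ge_atTop 1] with n h2 h3 h4
  have hn : (0 : ℝ) < n := by exact_mod_cast h4
  have h5 : 0 < a n + s := by linarith
  exact ⟨Real.rpow_pos_of_pos (by positivity) _, h2, radius_pow_mul_theta hd h5.le⟩

end Asymptotics

/-! ### The limits for the two processes -/

section Limits

variable {a : ℕ → ℝ} {k : ℕ}

/-- The second factorial moment is negligible against the first: distant pairs contribute the square
of the first moment, pairs at moderate distance lose an exponential factor, and close pairs are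
left with a factor `ε ^ d`. -/
lemma exists_tendsto_poissonPairBound_div_scaling (d : ℕ) (hk : 1 ≤ k)
    (ha : Tendsto (fun n : ℕ => a n - Real.log n - ((k : ℝ) - 1) * Real.log (Real.log n))
      atTop atTop) (s : ℝ) :
    ∃ C, ∀ ε > 0, Tendsto (fun n : ℕ => (n : ℝ) ^ 2 *
      poissonPairBound d k ε ((a n + s) / n) n / scaling k a n) atTop (𝓝 (ε ^ d * C)) := by
  obtain ⟨C, hC⟩ := exists_tendsto_mul_poissonCdf_pred_div k s
  refine ⟨C, fun ε hε => ?_⟩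
  have ha' := tendsto_atTop_of_tendsto_sub_log hk ha
  have hlam : Tendsto (fun n => a n + s) atTop atTop := tendsto_atTop_add_const_right _ _ ha'
  have h1 := (tendsto_poissonCdf_div hk s).comp ha'
  have h2 := (tendsto_mul_poissonCdf_atTop (c := (ε / 4) ^ d) (by positivity) k).comp hlam
  have h3 := hC.comp ha'
  have h4 := (((tendsto_scaling_zero hk ha).mul (h1.mul h1)).add
    ((h1.mul h2).const_mul (2 ^ d))).add (h3.const_mul (ε ^ d))
  simp only [zero_mul, mul_zero, zero_add] at h4
  refine h4.congr' ?_
  filter_upwards [ha'.eventually_gt_atTop 0, eventually_ge_atTop 1] with n hn1 hn2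
  have hn : (0 : ℝ) < n := by exact_mod_cast hn2
  have e1 : (n : ℝ) * ((a n + s) / n) = a n + s := by field_simp
  have e2 : (n : ℝ) * ((ε / 4) ^ d * ((a n + s) / n)) = (a n + s) * (ε / 4) ^ d := by
    field_simp
  simp only [Function.comp_apply, poissonPairBound, e1, e2, scaling]
  have hg : 0 < a n ^ (k - 1) * Real.exp (-a n) := by positivity
  field_simp

/-- Squeezing between a convergent first-moment bound and its correction by second-moment terms
whose limits are arbitrarily small. -/
lemma tendsto_of_moment_bounds {u F : ℕ → ℝ} {R : ℝ → ℕ → ℝ} {α C : ℝ} {d : ℕ} (hd : 1 ≤ d)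
    (hF : Tendsto F atTop (𝓝 α)) (hu : ∀ᶠ n in atTop, u n ≤ F n)
    (hR : ∀ ε, 0 < ε → ε ≤ 1 → Tendsto (R ε) atTop (𝓝 (ε ^ d * C)))
    (hl : ∀ ε, 0 < ε → ε ≤ 1 → ∀ᶠ n in atTop, F n - R ε n ≤ u n) :
    Tendsto u atTop (𝓝 α) := by
  refine tendsto_order.2 ⟨fun c hc => ?_, fun c hc => ?_⟩
  · have h0 : Tendsto (fun ε : ℝ => α - ε ^ d * C) (𝓝[>] 0) (𝓝 α) := by
      have : Continuous fun ε : ℝ => α - ε ^ d * C := by fun_prop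
      have h := (this.tendsto 0).mono_left (nhdsWithin_le_nhds (s := Set.Ioi 0))
      simpa [zero_pow (show d ≠ 0 by omega)] using h
    have h1 : ∀ᶠ ε : ℝ in 𝓝[>] 0, 0 < ε := eventually_mem_nhdsWithin
    have h2 : ∀ᶠ ε : ℝ in 𝓝[>] 0, ε ≤ 1 :=
      mem_nhdsWithin_of_mem_nhds (Iic_mem_nhds one_pos)
    obtain ⟨ε, hε1, hε2, hε3⟩ := ((h0.eventually_const_lt hc).and (h1.and h2)).exists
    filter_upwards [(hF.sub (hR ε hε2 hε3)).eventually_const_lt hε1, hl ε hε2 hε3] with n h1 h2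
    linarith
  · filter_upwards [hF.eventually_lt_const hc, hu] with n h1 h2
    linarith

lemma exp_neg_add_sq_le_one_sub {v : ℝ} (h1 : v ≤ 1 / 2) :
    Real.exp (-(v + 2 * v ^ 2)) ≤ 1 - v := by
  rw [Real.exp_neg, inv_le_comm₀ (Real.exp_pos _) (by linarith)]
  refine le_trans ?_ (Real.add_one_le_exp _)
  rw [inv_le_iff_one_le_mul₀ (by linarith)]
  nlinarith [mul_nonneg (sq_nonneg v) (by linarith : 0 ≤ 1 - 2 * v)]

/-- The exponential approximation of a binomial void probability; `lam n ^ 2 / n → 0` is what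
makes the quadratic term of `log (1 - lam n / n)` negligible. -/
lemma tendsto_one_sub_div_pow_mul_exp {lam : ℕ → ℝ} (hpos : ∀ᶠ n in atTop, 0 ≤ lam n)
    (h1 : Tendsto (fun n : ℕ => lam n / n) atTop (𝓝 0))
    (h2 : Tendsto (fun n : ℕ => lam n ^ 2 / n) atTop (𝓝 0)) (i : ℕ) :
    Tendsto (fun n : ℕ => (1 - lam n / n) ^ (n - 1 - i) * Real.exp (lam n)) atTop (𝓝 1) := by
  have hlow : Tendsto (fun n : ℕ => Real.exp (-(2 * (lam n ^ 2 / n)))) atTop (𝓝 1) := by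
    have h := (Real.continuous_exp.tendsto _).comp (h2.const_mul 2).neg
    simpa [Function.comp_def] using h
  have hupp : Tendsto (fun n : ℕ => Real.exp ((lam n / n) * (1 + i))) atTop (𝓝 1) := by
    have h := (Real.continuous_exp.tendsto _).comp (h1.mul_const (1 + (i : ℝ)))
    simpa [Function.comp_def] using h
  refine tendsto_of_tendsto_of_tendsto_of_le_of_le' hlow hupp ?_ ?_
  all_goals
    filter_upwards [hpos, h1.eventually_le_const (show (0 : ℝ) < 1 / 2 by norm_num),
      eventually_ge_atTop (i + 1)] with n hn1 hn2 hn3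
    have hn : (0 : ℝ) < n := by exact_mod_cast (by omega : 0 < n)
    have hl : ((n - 1 - i : ℕ) : ℝ) = n - 1 - i := by
      rw [Nat.cast_sub (by omega), Nat.cast_sub (by omega)]; simp
    have hv0 : 0 ≤ lam n / n := div_nonneg hn1 hn.le
    have hlam : lam n = n * (lam n / n) := by field_simp
    set v := lam n / n with hv
  · have h3 := pow_le_pow_left₀ (Real.exp_pos _).le (exp_neg_add_sq_le_one_sub hn2) (n - 1 - i)
    refine le_trans ?_ (mul_le_mul_of_nonneg_right h3 (Real.exp_pos _).le)
    rw [← Real.exp_nat_mul, ← Real.exp_add, Real.exp_le_exp, hl, hlam]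
    have e1 : ((n : ℝ) * v) ^ 2 / n = n * v ^ 2 := by field_simp
    rw [e1]
    have hi : (0 : ℝ) ≤ i := by positivity
    nlinarith [mul_nonneg hi hv0, mul_nonneg hi (sq_nonneg v), sq_nonneg v]
  · have h3 : (1 - v) ^ (n - 1 - i) ≤ Real.exp (-v) ^ (n - 1 - i) :=
      pow_le_pow_left₀ (by linarith) (by linarith [Real.add_one_le_exp (-v)]) _
    refine (mul_le_mul_of_nonneg_right h3 (Real.exp_pos _).le).trans ?_
    rw [← Real.exp_nat_mul, ← Real.exp_add, Real.exp_le_exp, hl, hlam]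
    nlinarith

lemma tendsto_choose_pred_mul_factorial_div_pow (i : ℕ) :
    Tendsto (fun n : ℕ => ((n - 1).choose i : ℝ) * i.factorial / (n : ℝ) ^ i) atTop (𝓝 1) := by
  have h : Tendsto (fun n : ℕ => ∏ j ∈ Finset.range i, (1 - ((1 : ℝ) + j) / n)) atTop (𝓝 1) := by
    have h := tendsto_finsetProd (Finset.range i) fun j _ =>
      (tendsto_const_nhds (x := (1 : ℝ)) (f := atTop)).sub
        (tendsto_const_div_atTop_nhds_zero_nat ((1 : ℝ) + j))
    simpa using h
  refine h.congr' ?_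
  filter_upwards [eventually_ge_atTop (i + 1)] with n hn
  have hn0 : (n : ℝ) ≠ 0 := by
    have : n ≠ 0 := by omega
    exact_mod_cast this
  have h1 : ((n - 1).choose i : ℝ) * i.factorial = ∏ j ∈ Finset.range i, ((n : ℝ) - (1 + j)) := by
    rw [mul_comm, ← Nat.cast_mul, ← Nat.descFactorial_eq_factorial_mul_choose,
      Nat.descFactorial_eq_prod_range, Nat.cast_prod]
    refine Finset.prod_congr rfl fun j hj => ?_
    have := Finset.mem_range.1 hj
    rw [Nat.cast_sub (by omega), Nat.cast_sub (by omega)]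
    simp
    ring
  have h2 : (n : ℝ) ^ i = ∏ _j ∈ Finset.range i, (n : ℝ) := by simp
  rw [h1, h2, ← Finset.prod_div_distrib]
  refine Finset.prod_congr rfl fun j _ => ?_
  field_simp

/-- For `a n = o(√n)`, the first moments of the binomial and the Poisson process agree to first
order. -/
lemma tendsto_binomial_first_moment_div_scaling (hk : 1 ≤ k) (ha : Tendsto a atTop atTop) (s : ℝ)
    (h1 : Tendsto (fun n : ℕ => (a n + s) / n) atTop (𝓝 0))
    (h2 : Tendsto (fun n : ℕ => (a n + s) ^ 2 / n) atTop (𝓝 0)) :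
    Tendsto (fun n : ℕ => n * trinomialCdf (n - 1) ((a n + s) / n) 0 k 1 / scaling k a n) atTop
      (𝓝 (alpha k s)) := by
  have hlam : Tendsto (fun n => a n + s) atTop atTop := tendsto_atTop_add_const_right _ _ ha
  have h := tendsto_finsetSum (Finset.range k) fun i hi =>
    (((tendsto_poissonWeight_div (k - 1) i (by have := Finset.mem_range.1 hi; omega) s).comp ha).mul
      (tendsto_choose_pred_mul_factorial_div_pow i)).mul
      (tendsto_one_sub_div_pow_mul_exp (hlam.eventually_ge_atTop 0) h1 h2 i)
  simp only [mul_one] at h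
  rw [Finset.sum_ite_eq', if_pos (Finset.mem_range.2 (by omega))] at h
  refine h.congr' ?_
  filter_upwards [ha.eventually_gt_atTop 0, eventually_ge_atTop 1] with n hn1 hn2
  have hn : (0 : ℝ) < n := by exact_mod_cast hn2
  rw [trinomialCdf, Finset.mul_sum, Finset.sum_div]
  refine Finset.sum_congr rfl fun i _ => ?_
  have hg : 0 < a n ^ (k - 1) * Real.exp (-a n) := by positivity
  have hE : Real.exp (-(a n + s)) * Real.exp (a n + s) = 1 := by rw [← Real.exp_add]; simp
  simp only [Function.comp_apply, poissonWeight, trinomialTerm, scaling, Finset.range_one,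
    Finset.sum_singleton, Nat.choose_zero_right, pow_zero, sub_zero, Nat.sub_zero, Nat.cast_one,
    mul_one, div_pow]
  generalize Real.exp (-a n) = y at *
  generalize Real.exp (-(a n + s)) = z at *
  generalize Real.exp (a n + s) = z' at *
  generalize (1 - (a n + s) / n) ^ (n - 1 - i) = p at *
  have hy : y ≠ 0 := by rintro rfl; simp at hg
  field_simp
  linear_combination ((n - 1).choose i : ℝ) * p * (a n + s) ^ i * hE

lemma tendsto_add_const_sq_div_natCast
    (ha : a =o[atTop] fun n : ℕ => (n : ℝ) ^ (1 / 3 : ℝ)) (s : ℝ) :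
    Tendsto (fun n : ℕ => (a n + s) ^ 2 / n) atTop (𝓝 0) := by
  have h1 : a =o[atTop] fun n : ℕ => (n : ℝ) ^ (1 / 2 : ℝ) := by
    refine ha.trans_isBigO (IsBigO.of_bound 1 ?_)
    filter_upwards [eventually_ge_atTop 1] with n hn
    have hn : (1 : ℝ) ≤ n := by exact_mod_cast hn
    rw [Real.norm_of_nonneg (by positivity), Real.norm_of_nonneg (by positivity), one_mul]
    exact Real.rpow_le_rpow_of_exponent_le hn (by norm_num)
  have h2 : Tendsto (fun n : ℕ => s / (n : ℝ) ^ (1 / 2 : ℝ)) atTop (𝓝 0) :=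
    ((tendsto_rpow_atTop (by norm_num)).comp tendsto_natCast_atTop_atTop).const_div_atTop s
  have h3 := (h1.tendsto_div_nhds_zero.add h2).pow 2
  simp only [add_zero, ne_eq, OfNat.ofNat_ne_zero, not_false_eq_true, zero_pow] at h3
  refine h3.congr fun n => ?_
  rw [← add_div, div_pow, ← Real.sqrt_eq_rpow, Real.sq_sqrt (by positivity)]

lemma isLittleO_natCast_of_isLittleO_rpow
    (ha : a =o[atTop] fun n : ℕ => (n : ℝ) ^ (1 / 3 : ℝ)) : a =o[atTop] fun n : ℕ => (n : ℝ) := by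
  refine ha.trans_isBigO (IsBigO.of_bound 1 ?_)
  filter_upwards [eventually_ge_atTop 1] with n hn
  have hn : (1 : ℝ) ≤ n := by exact_mod_cast hn
  rw [Real.norm_of_nonneg (by positivity), Real.norm_of_nonneg (by positivity), one_mul]
  exact Real.rpow_le_self_of_one_le hn (by norm_num)

variable {Ω : Type*} [MeasurableSpace Ω] {μ : Measure Ω} [IsProbabilityMeasure μ] {d : ℕ}

theorem tendsto_poisson (hd : 1 ≤ d) (hk : 1 ≤ k)
    (ha : Tendsto (fun n : ℕ => a n - Real.log n - ((k : ℝ) - 1) * Real.log (Real.log n))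
      atTop atTop) (s : ℝ) (hao : a =o[atTop] fun n : ℕ => (n : ℝ))
    {P : ℕ → Ω → Multiset (EuclideanSpace ℝ (Fin d))}
    (hP : ∀ n, 1 ≤ n → IsPoissonProcess (P n) ((n : ℝ≥0) • cubeMeasure d) μ) :
    Tendsto (fun n : ℕ => (scaling k a n)⁻¹ *
      μ.real {w | 1 ≤ lowDegreeCount k (radius d a s n) (P n w)}) atTop (𝓝 (alpha k s)) := by
  have ha' := tendsto_atTop_of_tendsto_sub_log hk ha
  have hr := eventually_radius hd hk ha hao s
  obtain ⟨C, hC⟩ := exists_tendsto_poissonPairBound_div_scaling d hk ha s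
  refine tendsto_of_moment_bounds hd (F := fun n => n * poissonCdf (a n + s) k / scaling k a n)
    ?_ ?_ (fun ε hε _ => hC ε hε) fun ε hε hε1 => ?_
  · refine ((tendsto_poissonCdf_div hk s).comp ha').congr' ?_
    filter_upwards [eventually_ge_atTop 1] with n hn
    have hn : (n : ℝ) ≠ 0 := by
      have : n ≠ 0 := by omega
      exact_mod_cast this
    rw [scaling, Function.comp_apply, mul_assoc, mul_div_mul_left _ _ hn]
  · filter_upwards [hr, ha'.eventually_gt_atTop 0, eventually_ge_atTop 1] with n hrn hn1 hn2
    have hn : (n : ℝ) ≠ 0 := by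
      have : n ≠ 0 := by omega
      exact_mod_cast this
    have h := (poisson_probability_bounds (hP n hn2) hd k hrn.1 hrn.2.1 one_pos le_rfl).1
    rw [hrn.2.2, NNReal.coe_natCast, mul_div_cancel₀ _ hn] at h
    rw [inv_mul_eq_div]
    exact div_le_div_of_nonneg_right h (scaling_pos hn2 hn1).le
  · filter_upwards [hr, ha'.eventually_gt_atTop 0, eventually_ge_atTop 1] with n hrn hn1 hn2
    have hn : (n : ℝ) ≠ 0 := by
      have : n ≠ 0 := by omega
      exact_mod_cast this
    have h := (poisson_probability_bounds (hP n hn2) hd k hrn.1 hrn.2.1 hε hε1).2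
    rw [hrn.2.2, NNReal.coe_natCast, mul_div_cancel₀ _ hn] at h
    rw [inv_mul_eq_div, ← sub_div]
    exact div_le_div_of_nonneg_right h (scaling_pos hn2 hn1).le

lemma tendsto_binomial_of_measurable (hd : 1 ≤ d) (hk : 1 ≤ k)
    (ha : Tendsto (fun n : ℕ => a n - Real.log n - ((k : ℝ) - 1) * Real.log (Real.log n))
      atTop atTop) (s : ℝ) (hao : a =o[atTop] fun n : ℕ => (n : ℝ) ^ (1 / 3 : ℝ))
    {X : ℕ → Ω → EuclideanSpace ℝ (Fin d)} (hX : ∀ i, Measurable (X i))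
    (hlaw : ∀ i, HasLaw (X i) (cubeMeasure d) μ) (hind : iIndepFun X μ) :
    Tendsto (fun n : ℕ => (scaling k a n)⁻¹ *
      μ.real {w | 1 ≤ lowDegreeCount k (radius d a s n) (binomialProcess X n w)}) atTop
      (𝓝 (alpha k s)) := by
  have ha' := tendsto_atTop_of_tendsto_sub_log hk ha
  have hao' := isLittleO_natCast_of_isLittleO_rpow hao
  have hr := eventually_radius hd hk ha hao' s
  obtain ⟨C, hC⟩ := exists_tendsto_poissonPairBound_div_scaling d hk ha s
  set B : ℝ := Real.exp (2 + (2 * k : ℕ)) with hB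
  refine tendsto_of_moment_bounds (C := B * C) (R := fun ε n => B * ((n : ℝ) ^ 2 *
      poissonPairBound d k ε ((a n + s) / n) n / scaling k a n)) hd
    (tendsto_binomial_first_moment_div_scaling hk ha' s (tendsto_add_const_div_natCast hao' s)
      (tendsto_add_const_sq_div_natCast hao s)) ?_ (fun ε hε _ => ?_) fun ε hε hε1 => ?_
  · filter_upwards [hr, ha'.eventually_gt_atTop 0, eventually_ge_atTop 1] with n hrn hn1 hn2
    have h := (binomial_probability_bounds hX hlaw hind hd k hrn.1 hrn.2.1 one_pos le_rfl n).1
    rw [hrn.2.2] at h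
    rw [inv_mul_eq_div]
    exact div_le_div_of_nonneg_right h (scaling_pos hn2 hn1).le
  · rw [mul_left_comm]
    exact (hC ε hε).const_mul B
  · filter_upwards [hr, ha'.eventually_gt_atTop 0, eventually_ge_atTop 2] with n hrn hn1 hn2
    have h := (binomial_probability_bounds hX hlaw hind hd k hrn.1 hrn.2.1 hε hε1 n).2
    have hv0 : 0 ≤ radius d a s n ^ d * theta d :=
      mul_nonneg (pow_nonneg hrn.1.le _) theta_nonneg
    have hv2 := two_mul_volume_le_one hd hrn.1 hrn.2.1
    have hpb := pairBound_le d hk (n - 2) hε.le hε1 hv0 hv2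
    have hpb0 := pairBound_nonneg d k (n - 2) hε.le hε1 hv0 hv2
    rw [hrn.2.2] at h hpb hpb0
    rw [Nat.cast_sub hn2, Nat.cast_ofNat, sub_add_cancel, ← hB] at hpb
    have hn : (2 : ℝ) ≤ n := by exact_mod_cast hn2
    rw [inv_mul_eq_div, ← mul_div_assoc, ← sub_div]
    refine div_le_div_of_nonneg_right (le_trans ?_ h) (scaling_pos (by omega) hn1).le
    have h3 : (n : ℝ) * (n - 1) * pairBound d k ε ((a n + s) / n) (n - 2) ≤
        (n : ℝ) ^ 2 * (B * poissonPairBound d k ε ((a n + s) / n) n) :=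
      mul_le_mul (by nlinarith) hpb hpb0 (by positivity)
    linarith

theorem tendsto_binomial (hd : 1 ≤ d) (hk : 1 ≤ k)
    (ha : Tendsto (fun n : ℕ => a n - Real.log n - ((k : ℝ) - 1) * Real.log (Real.log n))
      atTop atTop) (s : ℝ) (hao : a =o[atTop] fun n : ℕ => (n : ℝ) ^ (1 / 3 : ℝ))
    {X : ℕ → Ω → EuclideanSpace ℝ (Fin d)}
    (hlaw : ∀ i, HasLaw (X i) (cubeMeasure d) μ) (hind : iIndepFun X μ) :
    Tendsto (fun n : ℕ => (scaling k a n)⁻¹ *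
      μ.real {w | 1 ≤ lowDegreeCount k (radius d a s n) (binomialProcess X n w)}) atTop
      (𝓝 (alpha k s)) := by
  -- a law only determines an almost everywhere measurable map
  have hX : ∀ i, AEMeasurable (X i) μ := fun i => (hlaw i).aemeasurable
  have heq : ∀ i, X i =ᵐ[μ] (hX i).mk := fun i => (hX i).ae_eq_mk
  refine (tendsto_binomial_of_measurable hd hk ha s hao (fun i => (hX i).measurable_mk)
    (fun i => (hlaw i).congr (heq i).symm) (hind.congr heq)).congr fun n => ?_
  congr 1
  refine measureReal_congr ?_
  filter_upwards [ae_all_iff.2 heq] with w hw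
  have : binomialProcess (fun i => (hX i).mk) n w = binomialProcess X n w :=
    Multiset.map_congr rfl fun i _ => (hw i).symm
  exact congrArg (fun ω => 1 ≤ lowDegreeCount k (radius d a s n) ω) this

end Limits

end KNN

theorem corollary3p3 {Ω : Type*} [MeasurableSpace Ω] (μ : Measure Ω) [IsProbabilityMeasure μ]
    (d k : ℕ) (hd : 1 ≤ d) (hk : 1 ≤ k) (s₀ : ℝ) (a : ℕ → ℝ)
    (ha : Tendsto (fun n : ℕ => a n - Real.log n - ((k : ℝ) - 1) * Real.log (Real.log n))
      atTop atTop) :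
    (a =o[atTop] (fun n : ℕ => (n : ℝ)) →
      ∀ P : ℕ → Ω → Multiset (EuclideanSpace ℝ (Fin d)),
        (∀ n, 1 ≤ n → KNN.IsPoissonProcess (P n) ((n : ℝ≥0) • KNN.cubeMeasure d) μ) →
        Tendsto (fun n : ℕ => (KNN.scaling k a n)⁻¹ *
            μ.real {w | 1 ≤ KNN.lowDegreeCount k (KNN.radius d a s₀ n) (P n w)})
          atTop (𝓝 (KNN.alpha k s₀))) ∧
    (a =o[atTop] (fun n : ℕ => (n : ℝ) ^ (1 / 3 : ℝ)) →
      ∀ X : ℕ → Ω → EuclideanSpace ℝ (Fin d),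
        (∀ i, HasLaw (X i) (KNN.cubeMeasure d) μ) → iIndepFun X μ →
        Tendsto (fun n : ℕ => (KNN.scaling k a n)⁻¹ *
            μ.real {w | 1 ≤ KNN.lowDegreeCount k (KNN.radius d a s₀ n)
              (KNN.binomialProcess X n w)})
          atTop (𝓝 (KNN.alpha k s₀))) :=
  ⟨fun hao _ hP => KNN.tendsto_poisson hd hk ha s₀ hao hP,
    fun hao _ hlaw hind => KNN.tendsto_binomial hd hk ha s₀ hao hlaw hind⟩
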